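/- Let $\Sigma=\Gamma\backslash\mathbb D$ be a closed oriented hyperbolic surface, where $\mathbb D$ is the Poincar\'e disc, $\overline{\mathbb D}$ the closed disc, $S^1=\partial\mathbb D$, and $\Gamma\cong\pi_1(\Sigma)$ is the group of deck transformations (orientation-preserving isometries of $\mathbb D$ acting freely, properly discontinuously and cocompactly). For a set $X$ let $\Delta$ denote the diagonal of $X\times X$, and let * $G=(S^1\times S^1\setminus\Delta)/\mathbb Z_2$ be the space of unoriented bi-infinite geodesics, * $GS=(\overline{\mathbb D}\times\overline{\mathbb D}\setminus\Delta)/\mathbb Z_2$ be the space of unoriented (finite, half-infinite or bi-infinite) geodesic segments, $\mathbb Z_2$ exchanging the endpoints, * $CS=\mathbb PT^\infty\mathbb D$ be the space of centered geodesic segments: the quotient, by the antipodal map of the fibres, of the tangent bundle with every tangent plane compactified by a circle at infinity; the class of $(x,v)$ stands for the segment with center $x$, direction $v$ and hyperbolic length $2\|v\|\in[0,\infty]$. The group $\Gamma$ acts on each of these spaces. Let $\mathcal{GC}(\Sigma)$, $\mathcal{GCC}(\Sigma)$ and $\mathcal{CGCC}(\Sigma)$ (geodesic currents, currents with corners, centered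 currents with corners) be the sets of $\Gamma$-invariant Radon measures, finite on compact sets, on $G$, $GS$ and $CS$, respectively. Give $\mathcal{GC}(\Sigma)$ and $\mathcal{CGCC}(\Sigma)$ the weak-$*$ topology (the coarsest one for which $\mu\mapsto\int f\,d\mu$ is continuous for every compactly supported continuous real function $f$). A segmented flow box is the set $B\subset GS$ of all segments with one endpoint in $D_{\epsilon_1}(x_1)$ and the other in $D_{\epsilon_2}(x_2)$, where $x_1,x_2\in\overline{\mathbb D}$, $\epsilon_1,\epsilon_2>0$ and the Euclidean discs $D_{\epsilon_i}(x_i)$ of radius $\epsilon_i$ about $x_i$ have disjoint closures; it is $\mu$-admissible if $\mu(\partial B)=0$. Give $\mathcal{GCC}(\Sigma)$ the topology in which a set $V$ is open if and only if for every $\mu\in V$ there are a finite collection $\mathcal B$ of $\mu$-admissible segmented flow boxes and an $\epsilon>0$ such that $V$ contains $\{\nu:\ |\mu(B)-\nu(B)|<\epsilon\ \ \forall B\in\mathcal B\}$. Then: 1. For every $\mu\in\mathcal{GC}(\Sigma)$ the push-forward of $\mu$ under the inclusion $G\hookrightarrow GS$ belongs to $\mathcal{GCC}(\Sigma)$, and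 the resulting inclusion $\mathcal{GC}(\Sigma)\hookrightarrow\mathcal{GCC}(\Sigma)$ is a topological embedding with closed image. 2. For $\gamma\in G$ let $\lambda_\gamma$ be the measure on $CS$ that is the image of hyperbolic arclength on $\gamma$ under the map that sends $x\in\gamma$ to the bi-infinite segment with center $x$ tangent to $\gamma$. For every $\mu\in\mathcal{GC}(\Sigma)$ the measure $A\mapsto\int_G\lambda_\gamma(A)\,d\mu(\gamma)$, which is carried by the bi-infinite centered segments, belongs to $\mathcal{CGCC}(\Sigma)$, and the resulting inclusion $\mathcal{GC}(\Sigma)\hookrightarrow\mathcal{CGCC}(\Sigma)$ is a topological embedding with closed image. -/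

import Mathlib

open MeasureTheory Topology Filter
open scoped ComplexConjugate CompactlySupported MatrixGroups

noncomputable section

namespace CurrentsWithCorners

open Complex (UnitDisc UnitClosedDisc)

/-! ## The hyperbolic plane: the Poincare disc and its isometries

`UnitDisc` is the open unit disc, with the hyperbolic metric `2 |dz| / (1 - |z|^2)`,
`UnitClosedDisc` is its compactification, and `Circle` is the circle at infinity. -/

/-- The group `SU(1,1)` of complex matrices `(a, b; conj b, conj a)` of determinant `1`.
It acts by `z ↦ (a z + b) / (conj b z + conj a)`, and `SU(1,1) / {1, -1}` is the group of all
orientation-preserving isometries of the Poincare disc. -/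
def su11Subgroup : Subgroup SL(2, ℂ) where
  carrier := {g | g 1 0 = conj (g 0 1) ∧ g 1 1 = conj (g 0 0)}
  mul_mem' := by
    rintro g h ⟨hg, hg'⟩ ⟨hh, hh'⟩
    simp only [Set.mem_ofPred_eq, Matrix.SpecialLinearGroup.coe_mul, Matrix.mul_apply,
      Fin.sum_univ_two, hg, hg', hh, hh', map_add, map_mul, Complex.conj_conj]
    constructor <;> ring
  one_mem' := by simp
  inv_mem' := by
    rintro g ⟨hg, hg'⟩
    change g⁻¹ 1 0 = conj (g⁻¹ 0 1) ∧ g⁻¹ 1 1 = conj (g⁻¹ 0 0)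
    simp [Matrix.SpecialLinearGroup.SL2_inv_expl, hg, hg']

/-- The group `SU(1,1)`, as a type. -/
abbrev SU11 : Type := su11Subgroup

/-- The entry `a` of the matrix `(a, b; conj b, conj a)`. -/
def SU11.a (g : SU11) : ℂ := g.1 0 0

/-- The entry `b` of the matrix `(a, b; conj b, conj a)`. -/
def SU11.b (g : SU11) : ℂ := g.1 0 1

theorem SU11.det_eq (g : SU11) : g.a * conj g.a - g.b * conj g.b = 1 := by
  have h := g.1.det_coe
  rw [Matrix.det_fin_two, g.2.1, g.2.2] at h
  exact h

theorem SU11.norm_b_lt (g : SU11) : ‖g.b‖ < ‖g.a‖ := by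
  have h := g.det_eq
  rw [Complex.mul_conj, Complex.mul_conj, Complex.normSq_eq_norm_sq,
    Complex.normSq_eq_norm_sq] at h
  have h' : ‖g.a‖ ^ 2 - ‖g.b‖ ^ 2 = 1 := by exact_mod_cast h
  nlinarith [norm_nonneg g.a, norm_nonneg g.b]

theorem norm_den_sq_sub (a b z : ℂ) :
    ‖conj b * z + conj a‖ ^ 2 - ‖a * z + b‖ ^ 2
      = (‖a‖ ^ 2 - ‖b‖ ^ 2) * (1 - ‖z‖ ^ 2) := by
  simp only [← Complex.normSq_eq_norm_sq, Complex.normSq_apply, Complex.add_re, Complex.add_im,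
    Complex.mul_re, Complex.mul_im, Complex.conj_re, Complex.conj_im]
  ring

theorem den_ne_zero {a b z : ℂ} (h : ‖b‖ < ‖a‖) (hz : ‖z‖ ≤ 1) : conj b * z + conj a ≠ 0 := by
  intro h0
  have h1 : ‖conj a‖ = ‖conj b * z‖ := by
    rw [eq_neg_of_add_eq_zero_right h0, norm_neg]
  rw [norm_mul, RCLike.norm_conj, RCLike.norm_conj] at h1
  nlinarith [norm_nonneg b]

theorem norm_mobius_lt_one {a b z : ℂ} (h : ‖b‖ < ‖a‖) (hz : ‖z‖ < 1) :
    ‖(a * z + b) / (conj b * z + conj a)‖ < 1 := by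
  have hd := norm_pos_iff.2 (den_ne_zero h hz.le)
  rw [norm_div, div_lt_one hd]
  have h1 := norm_den_sq_sub a b z
  have h2 : 0 < (‖a‖ ^ 2 - ‖b‖ ^ 2) * (1 - ‖z‖ ^ 2) := by
    apply mul_pos <;> nlinarith [norm_nonneg a, norm_nonneg b, norm_nonneg z]
  exact lt_of_pow_lt_pow_left₀ 2 hd.le (by linarith)

theorem norm_mobius_le_one {a b z : ℂ} (h : ‖b‖ < ‖a‖) (hz : ‖z‖ ≤ 1) :
    ‖(a * z + b) / (conj b * z + conj a)‖ ≤ 1 := by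
  have hd := norm_pos_iff.2 (den_ne_zero h hz)
  rw [norm_div, div_le_one hd]
  have h1 := norm_den_sq_sub a b z
  have h2 : 0 ≤ (‖a‖ ^ 2 - ‖b‖ ^ 2) * (1 - ‖z‖ ^ 2) := by
    apply mul_nonneg <;> nlinarith [norm_nonneg a, norm_nonneg b, norm_nonneg z]
  exact le_of_sq_le_sq (by linarith) hd.le
where
  le_of_sq_le_sq {x y : ℝ} (hxy : x ^ 2 ≤ y ^ 2) (hy : 0 ≤ y) : x ≤ y :=
    (abs_le_of_sq_le_sq' hxy hy).2

theorem norm_mobius_eq_one {a b z : ℂ} (h : ‖b‖ < ‖a‖) (hz : ‖z‖ = 1) :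
    ‖(a * z + b) / (conj b * z + conj a)‖ = 1 := by
  have hd := norm_pos_iff.2 (den_ne_zero h hz.le)
  rw [norm_div, div_eq_one_iff_eq hd.ne']
  have h1 := norm_den_sq_sub a b z
  rw [hz] at h1
  exact (pow_left_inj₀ (norm_nonneg _) hd.le two_ne_zero).1 (by linarith)

/-- The Moebius transformation `z ↦ (a z + b) / (conj b z + conj a)`. -/
def SU11.mobius (g : SU11) (z : ℂ) : ℂ := (g.a * z + g.b) / (conj g.b * z + conj g.a)

theorem SU11.mobius_inj (g : SU11) {z w : ℂ} (hz : ‖z‖ ≤ 1) (hw : ‖w‖ ≤ 1)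
    (h : g.mobius z = g.mobius w) : z = w := by
  unfold SU11.mobius at h
  rw [div_eq_div_iff (den_ne_zero g.norm_b_lt hz) (den_ne_zero g.norm_b_lt hw)] at h
  linear_combination h + (w - z) * g.det_eq

/-- The action on the hyperbolic plane. -/
def SU11.onDisc (g : SU11) (z : UnitDisc) : UnitDisc :=
  UnitDisc.mk (g.mobius z) (norm_mobius_lt_one g.norm_b_lt z.norm_lt_one)

/-- The action on the compactified hyperbolic plane. -/
def SU11.onClosedDisc (g : SU11) (z : UnitClosedDisc) : UnitClosedDisc :=
  UnitClosedDisc.mk (g.mobius z) (norm_mobius_le_one g.norm_b_lt z.norm_le_one)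

/-- The action on the circle at infinity. -/
def SU11.onCircle (g : SU11) (z : Circle) : Circle :=
  ⟨g.mobius z, mem_sphere_zero_iff_norm.2 (norm_mobius_eq_one g.norm_b_lt z.norm_coe)⟩

theorem SU11.onClosedDisc_injective (g : SU11) : Function.Injective g.onClosedDisc := by
  intro z w h
  exact UnitClosedDisc.coe_injective (g.mobius_inj z.norm_le_one w.norm_le_one
    (congrArg UnitClosedDisc.coe h))

theorem SU11.onCircle_injective (g : SU11) : Function.Injective g.onCircle := by
  intro z w h
  exact Circle.ext (g.mobius_inj z.norm_coe.le w.norm_coe.le (congrArg (fun c : Circle => (c : ℂ)) h))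

/-- For a complex number `q ≠ 0`, the unit complex number `conj q / q = |q| ^ 2 / q ^ 2`. -/
def unitInvSq (q : ℂ) (hq : q ≠ 0) : Circle :=
  ⟨conj q / q, mem_sphere_zero_iff_norm.2 (by
    rw [norm_div, RCLike.norm_conj, div_self (norm_ne_zero_iff.2 hq)])⟩

/-- The unit complex number `g'(x) / |g'(x)|`; the derivative of the Moebius transformation `g`
at `x` is `g'(x) = 1 / (conj b x + conj a) ^ 2`. -/
def SU11.unitDeriv (g : SU11) (x : UnitDisc) : Circle :=
  unitInvSq (conj g.b * x + conj g.a) (den_ne_zero g.norm_b_lt x.norm_lt_one.le)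

/-! ## Closed hyperbolic surfaces -/

/-- A closed oriented hyperbolic surface, given as the quotient of its universal covering, the
Poincare disc, by the group of deck transformations: a group of orientation-preserving
isometries, acting freely, properly discontinuously and cocompactly. The group of deck
transformations is the image in `SU(1,1) / {1, -1}` of the subgroup `deck` of `SU(1,1)`. -/
structure ClosedHyperbolicSurface where
  /-- The (lifted) group of deck transformations. -/
  deck : Subgroup SU11
  free : ∀ g ∈ deck, ∀ z : UnitDisc, g.onDisc z = z → ∀ w : UnitDisc, g.onDisc w = w
  properlyDiscontinuous : ∀ K : Set UnitDisc, IsCompact K →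
    {g : SU11 | g ∈ deck ∧ (g.onDisc '' K ∩ K).Nonempty}.Finite
  cocompact : ∃ K : Set UnitDisc, IsCompact K ∧ ∀ z : UnitDisc, ∃ g ∈ deck, g.onDisc z ∈ K

/-! ## Geodesics and geodesic segments -/

/-- The equivalence relation on `X × X` minus the diagonal that forgets the order. -/
def swapSetoid (X : Type) : Setoid {p : X × X // p.1 ≠ p.2} where
  r p q := q.1 = p.1 ∨ q.1 = p.1.swap
  iseqv :=
    { refl := fun _ => Or.inl rfl
      symm := by
        rintro p q (h | h)
        · exact Or.inl h.symm
        · exact Or.inr (by rw [h, Prod.swap_swap])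
      trans := by
        rintro p q r (h | h) (h' | h')
        · exact Or.inl (h'.trans h)
        · exact Or.inr (by rw [h', h])
        · exact Or.inr (by rw [h', h])
        · exact Or.inl (by rw [h', h, Prod.swap_swap]) }

/-- The space `(X × X minus the diagonal) / (ℤ/2)` with the quotient topology. -/
def UnorderedPair (X : Type) : Type := Quotient (swapSetoid X)

/-- The unordered pair with entries `x` and `y`. -/
def UnorderedPair.mk {X : Type} (x y : X) (h : x ≠ y) : UnorderedPair X :=
  Quotient.mk (swapSetoid X) ⟨(x, y), h⟩

theorem UnorderedPair.mk_swap {X : Type} (x y : X) (h : x ≠ y) :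
    UnorderedPair.mk x y h = UnorderedPair.mk y x h.symm :=
  Quotient.sound (s := swapSetoid X) (Or.inr rfl)

instance (X : Type) [TopologicalSpace X] : TopologicalSpace (UnorderedPair X) :=
  inferInstanceAs (TopologicalSpace (Quotient (swapSetoid X)))

instance (X : Type) [TopologicalSpace X] : MeasurableSpace (UnorderedPair X) :=
  borel (UnorderedPair X)

instance (X : Type) [TopologicalSpace X] : BorelSpace (UnorderedPair X) := ⟨rfl⟩

/-- The map on unordered pairs that is induced by an injective map. -/
def UnorderedPair.map {X Y : Type} (f : X → Y) (hf : Function.Injective f) :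
    UnorderedPair X → UnorderedPair Y :=
  Quotient.lift
    (fun p : {p : X × X // p.1 ≠ p.2} =>
      UnorderedPair.mk (f p.1.1) (f p.1.2) (fun h => p.2 (hf h)))
    (by
      rintro ⟨⟨x, y⟩, h⟩ ⟨⟨x', y'⟩, h'⟩ (e | e)
      · obtain ⟨rfl, rfl⟩ := Prod.mk.inj e
        rfl
      · obtain ⟨rfl, rfl⟩ := Prod.mk.inj e
        exact UnorderedPair.mk_swap _ _ _)

/-- The space of unoriented bi-infinite geodesics: unordered pairs of distinct points of the
circle at infinity. -/
abbrev Geodesics : Type := UnorderedPair Circle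

/-- The space of unoriented geodesic segments, possibly half-infinite or bi-infinite: unordered
pairs of distinct points of the closed disc. -/
abbrev GeodesicSegments : Type := UnorderedPair UnitClosedDisc

/-- The inclusion of the circle at infinity into the closed disc. -/
def circleToClosedDisc (z : Circle) : UnitClosedDisc := UnitClosedDisc.mk z z.norm_coe.le

theorem circleToClosedDisc_injective : Function.Injective circleToClosedDisc := by
  intro z w h
  exact Circle.ext (congrArg UnitClosedDisc.coe h)

/-- A bi-infinite geodesic as a geodesic segment. -/
def geodesicToSegment : Geodesics → GeodesicSegments :=
  UnorderedPair.map circleToClosedDisc circleToClosedDisc_injective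

/-- The action of isometries on bi-infinite geodesics. -/
def actGeodesics (g : SU11) : Geodesics → Geodesics :=
  UnorderedPair.map g.onCircle g.onCircle_injective

/-- The action of isometries on geodesic segments. -/
def actSegments (g : SU11) : GeodesicSegments → GeodesicSegments :=
  UnorderedPair.map g.onClosedDisc g.onClosedDisc_injective

/-! ## Centered geodesic segments

A tangent vector `v` of the disc at `x` of hyperbolic length `ℓ` is represented by the pair
`(x, w)`, where `w` has the direction of `v` and Euclidean length `tanh (ℓ / 2)`. The compactification
of every tangent plane by a circle at infinity is obtained by allowing `ℓ = ∞`, that is, `|w| = 1`.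
So the fibrewise compactified tangent bundle is `UnitDisc × UnitClosedDisc`. -/

/-- The equivalence relation `(x, w) ∼ (x, -w)`. -/
def antipodalSetoid : Setoid (UnitDisc × UnitClosedDisc) where
  r p q := q = p ∨ q = (p.1, -p.2)
  iseqv :=
    { refl := fun _ => Or.inl rfl
      symm := by
        rintro p q (h | h)
        · exact Or.inl h.symm
        · exact Or.inr (by rw [h]; simp)
      trans := by
        rintro p q r (h | h) (h' | h')
        · exact Or.inl (h'.trans h)
        · exact Or.inr (by rw [h', h])
        · exact Or.inr (by rw [h', h])
        · exact Or.inl (by rw [h', h]; simp) }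

/-- The space of centered geodesic segments: the quotient of the fibrewise compactified tangent
bundle by the antipodal map of the fibres. The class of a vector `v` at `x` stands for the
geodesic segment with center `x`, direction `v` and length `2 ‖v‖`. -/
def CenteredSegments : Type := Quotient antipodalSetoid

/-- The class of `(x, w)` and `(x, -w)`. -/
def CenteredSegments.mk (x : UnitDisc) (w : UnitClosedDisc) : CenteredSegments :=
  Quotient.mk antipodalSetoid (x, w)

theorem CenteredSegments.mk_neg (x : UnitDisc) (w : UnitClosedDisc) :
    CenteredSegments.mk x (-w) = CenteredSegments.mk x w :=
  (Quotient.sound (s := antipodalSetoid) (a := (x, w)) (b := (x, -w)) (Or.inr rfl)).symm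

instance : TopologicalSpace CenteredSegments :=
  inferInstanceAs (TopologicalSpace (Quotient antipodalSetoid))

instance : MeasurableSpace CenteredSegments := borel CenteredSegments

instance : BorelSpace CenteredSegments := ⟨rfl⟩

/-- The action of isometries on centered segments, by the differential: `x` is moved by `g`, the
hyperbolic length of a tangent vector is preserved, and its direction is turned by `g'(x)`. -/
def actCentered (g : SU11) : CenteredSegments → CenteredSegments :=
  Quotient.lift
    (fun p : UnitDisc × UnitClosedDisc =>
      CenteredSegments.mk (g.onDisc p.1) (g.unitDeriv p.1 • p.2))
    (by
      rintro ⟨x, w⟩ q (rfl | rfl)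
      · rfl
      · have h : g.unitDeriv x • (-w) = -(g.unitDeriv x • w) :=
          UnitClosedDisc.coe_injective (by simp)
        change CenteredSegments.mk _ _ = CenteredSegments.mk _ (_ • (-w))
        rw [h, CenteredSegments.mk_neg])

/-! ## Parametrization of a bi-infinite geodesic by arclength

The geodesic with endpoints `ξ ≠ η` on the circle has the Euclidean midpoint
`c = (ξ + η) / (2 + |ξ - η|)`, and there the unit direction `u = (η - ξ) / |η - ξ|` towards `η`.
It is parametrized by hyperbolic arclength by
`t ↦ (u s + c) / (1 + conj c u s)` with `s = tanh (t / 2)`, and its direction at that point is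
`u / (1 + conj c u s) ^ 2`, up to a positive factor. -/

/-- The Euclidean midpoint `c` of a geodesic. -/
def centerPoint (ξ η : Circle) : ℂ := (ξ + η) / (2 + ‖(ξ : ℂ) - η‖ : ℝ)

/-- The unit direction `u` of a geodesic at its Euclidean midpoint. -/
def centerDirection (ξ η : Circle) : ℂ := (η - ξ) / (‖(ξ : ℂ) - η‖ : ℝ)

theorem norm_centerPoint_lt_one {ξ η : Circle} (h : ξ ≠ η) : ‖centerPoint ξ η‖ < 1 := by
  have h0 : 0 < ‖(ξ : ℂ) - η‖ := norm_pos_iff.2 (sub_ne_zero.2 (fun e => h (Circle.ext e)))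
  have h1 : ‖(ξ : ℂ) + η‖ ≤ 2 := by
    refine (norm_add_le _ _).trans ?_
    rw [ξ.norm_coe, η.norm_coe]
    norm_num
  unfold centerPoint
  rw [norm_div, Complex.norm_real, Real.norm_of_nonneg (by linarith), div_lt_one (by linarith)]
  linarith

theorem norm_centerDirection {ξ η : Circle} (h : ξ ≠ η) : ‖centerDirection ξ η‖ = 1 := by
  have h0 : 0 < ‖(ξ : ℂ) - η‖ := norm_pos_iff.2 (sub_ne_zero.2 (fun e => h (Circle.ext e)))
  unfold centerDirection
  rw [norm_div, Complex.norm_real, Real.norm_of_nonneg h0.le, norm_sub_rev, div_self]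
  exact h0.ne'

theorem norm_centerDirection_mul_lt {ξ η : Circle} (h : ξ ≠ η) (t : ℝ) :
    ‖centerDirection ξ η * (Real.tanh (t / 2) : ℝ)‖ < 1 := by
  rw [norm_mul, norm_centerDirection h, one_mul, Complex.norm_real, Real.norm_eq_abs]
  exact Real.abs_tanh_lt_one _

/-- The denominator `1 + conj c u s` with `s = tanh (t / 2)`. -/
def geodesicDen (ξ η : Circle) (t : ℝ) : ℂ :=
  conj (centerPoint ξ η) * (centerDirection ξ η * (Real.tanh (t / 2) : ℝ)) + conj 1

theorem geodesicDen_ne_zero {ξ η : Circle} (h : ξ ≠ η) (t : ℝ) : geodesicDen ξ η t ≠ 0 :=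
  den_ne_zero (by rw [norm_one]; exact norm_centerPoint_lt_one h)
    (norm_centerDirection_mul_lt h t).le

/-- The point at time `t` of the geodesic from `ξ` to `η`, parametrized by hyperbolic arclength. -/
def geodesicPoint (ξ η : Circle) (h : ξ ≠ η) (t : ℝ) : UnitDisc :=
  UnitDisc.mk
    ((1 * (centerDirection ξ η * (Real.tanh (t / 2) : ℝ)) + centerPoint ξ η) / geodesicDen ξ η t)
    (norm_mobius_lt_one (by rw [norm_one]; exact norm_centerPoint_lt_one h)
      (norm_centerDirection_mul_lt h t))

/-- The unit direction at time `t` of the geodesic from `ξ` to `η`, as a point on the circle at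
infinity of the compactified tangent plane. -/
def geodesicDirection (ξ η : Circle) (h : ξ ≠ η) (t : ℝ) : UnitClosedDisc :=
  unitInvSq (geodesicDen ξ η t) (geodesicDen_ne_zero h t) •
    UnitClosedDisc.mk (centerDirection ξ η) (norm_centerDirection h).le

/-- The bi-infinite geodesic from `ξ` to `η`, as a centered segment of infinite length with
center the point at time `t`. -/
def centeredAt (ξ η : Circle) (h : ξ ≠ η) (t : ℝ) : CenteredSegments :=
  CenteredSegments.mk (geodesicPoint ξ η h t) (geodesicDirection ξ η h t)

theorem centeredAt_swap (ξ η : Circle) (h : ξ ≠ η) (t : ℝ) :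
    centeredAt η ξ h.symm (-t) = centeredAt ξ η h t := by
  have hc : centerPoint η ξ = centerPoint ξ η := by
    unfold centerPoint
    rw [norm_sub_rev, add_comm (η : ℂ)]
  have hu : centerDirection η ξ = -centerDirection ξ η := by
    unfold centerDirection
    rw [norm_sub_rev, ← neg_div, neg_sub]
  have hs : centerDirection η ξ * (Real.tanh (-t / 2) : ℝ)
      = centerDirection ξ η * (Real.tanh (t / 2) : ℝ) := by
    rw [hu, neg_div, Real.tanh_neg]
    push_cast
    ring
  have hd : geodesicDen η ξ (-t) = geodesicDen ξ η t := by
    unfold geodesicDen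
    rw [hc, hs]
  have hp : geodesicPoint η ξ h.symm (-t) = geodesicPoint ξ η h t := by
    unfold geodesicPoint
    simp only [hc, hs, hd]
  have hw : geodesicDirection η ξ h.symm (-t) = -geodesicDirection ξ η h t := by
    apply UnitClosedDisc.coe_injective
    unfold geodesicDirection
    simp only [hd, hu]
    simp
  unfold centeredAt
  rw [hp, hw, CenteredSegments.mk_neg]

/-- The arclength measure of a bi-infinite geodesic `γ`, as a measure on centered segments: it is
carried by the copies of `γ` centered at the points of `γ`, and it measures the set of the
centers by their hyperbolic length along `γ`. -/
def arclengthMeasure : Geodesics → Measure CenteredSegments :=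
  Quotient.lift
    (fun p : {p : Circle × Circle // p.1 ≠ p.2} =>
      (volume : Measure ℝ).map (centeredAt p.1.1 p.1.2 p.2))
    (by
      have key : ∀ (ξ η : Circle) (h : ξ ≠ η),
          (volume : Measure ℝ).map (centeredAt ξ η h)
            = (volume : Measure ℝ).map (centeredAt η ξ h.symm) := by
        intro ξ η h
        have e : centeredAt ξ η h = centeredAt η ξ h.symm ∘ (MeasurableEquiv.neg ℝ) := by
          funext t
          exact (centeredAt_swap ξ η h t).symm
        have hcont : Continuous (centeredAt η ξ h.symm) := by
          have hT0 : Continuous Real.tanh := by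
            have : Real.tanh = fun x => Real.sinh x / Real.cosh x :=
              funext Real.tanh_eq_sinh_div_cosh
            rw [this]
            exact Real.continuous_sinh.div Real.continuous_cosh (fun x => (Real.cosh_pos x).ne')
          have hT : Continuous fun t : ℝ => ((Real.tanh (t / 2) : ℝ) : ℂ) :=
            Complex.continuous_ofReal.comp (hT0.comp (by fun_prop : Continuous fun t : ℝ => t / 2))
          have hD : Continuous (geodesicDen η ξ) := by
            unfold geodesicDen
            fun_prop
          have h1 : Continuous (geodesicPoint η ξ h.symm) := by
            rw [UnitDisc.isEmbedding_coe.continuous_iff]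
            exact ((continuous_const.mul (continuous_const.mul hT)).add continuous_const).div hD
              (geodesicDen_ne_zero h.symm)
          have h2 : Continuous (geodesicDirection η ξ h.symm) := by
            rw [UnitClosedDisc.isEmbedding_coe.continuous_iff]
            exact ((Complex.continuous_conj.comp hD).div hD
              (geodesicDen_ne_zero h.symm)).mul continuous_const
          exact (continuous_quotient_mk' (s := antipodalSetoid)).comp (h1.prodMk h2)
        rw [e, ← Measure.map_map hcont.measurable (MeasurableEquiv.neg ℝ).measurable]
        congr 1
        exact Measure.map_neg_eq_self (volume : Measure ℝ)
      rintro ⟨⟨x, y⟩, h⟩ ⟨⟨x', y'⟩, h'⟩ (e | e)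
      · obtain ⟨rfl, rfl⟩ := Prod.mk.inj e
        rfl
      · obtain ⟨rfl, rfl⟩ := Prod.mk.inj e
        exact key _ _ _)

/-! ## Currents -/

/-- The Radon measures on `Y` (regular Borel measures, finite on compact sets) that are invariant
under the elements of `Γ`, acting through `act`. -/
def InvariantRadonMeasure (Γ : Subgroup SU11) (Y : Type) [TopologicalSpace Y] [MeasurableSpace Y]
    (act : SU11 → Y → Y) : Type :=
  {μ : Measure Y // μ.Regular ∧ ∀ g ∈ Γ, μ.map (act g) = μ}

/-- The weak* topology: the coarsest topology for which the integral of every compactly supported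
continuous function is continuous. -/
@[reducible]
def weakStarTopology (Γ : Subgroup SU11) (Y : Type) [TopologicalSpace Y] [MeasurableSpace Y]
    (act : SU11 → Y → Y) : TopologicalSpace (InvariantRadonMeasure Γ Y act) :=
  TopologicalSpace.induced (fun μ (f : C_c(Y, ℝ)) => ∫ y, f y ∂μ.1) inferInstance

/-- Geodesic currents on a closed hyperbolic surface. -/
def GeodesicCurrent (S : ClosedHyperbolicSurface) : Type :=
  InvariantRadonMeasure S.deck Geodesics actGeodesics

/-- Geodesic currents with corners on a closed hyperbolic surface. -/
def CurrentWithCorners (S : ClosedHyperbolicSurface) : Type :=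
  InvariantRadonMeasure S.deck GeodesicSegments actSegments

/-- Centered geodesic currents with corners on a closed hyperbolic surface. -/
def CenteredCurrentWithCorners (S : ClosedHyperbolicSurface) : Type :=
  InvariantRadonMeasure S.deck CenteredSegments actCentered

/-- The segmented flow box: the segments with one endpoint in the open Euclidean disc of radius
`ε₁` about `x₁` and the other one in the open Euclidean disc of radius `ε₂` about `x₂`. -/
def segmentedFlowBox (x₁ x₂ : UnitClosedDisc) (ε₁ ε₂ : ℝ) : Set GeodesicSegments :=
  {γ | ∃ (z w : UnitClosedDisc) (h : z ≠ w), ‖(z : ℂ) - x₁‖ < ε₁ ∧ ‖(w : ℂ) - x₂‖ < ε₂ ∧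
    γ = UnorderedPair.mk z w h}

/-- Being a segmented flow box, with positive radii and with discs whose closures are disjoint. -/
def IsSegmentedFlowBox (B : Set GeodesicSegments) : Prop :=
  ∃ (x₁ x₂ : UnitClosedDisc) (ε₁ ε₂ : ℝ), 0 < ε₁ ∧ 0 < ε₂ ∧
    Disjoint (Metric.closedBall (x₁ : ℂ) ε₁) (Metric.closedBall (x₂ : ℂ) ε₂) ∧
    B = segmentedFlowBox x₁ x₂ ε₁ ε₂

/-- A `μ`-admissible segmented flow box: its boundary has measure `0`. -/
def IsAdmissible (μ : Measure GeodesicSegments) (B : Set GeodesicSegments) : Prop :=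
  IsSegmentedFlowBox B ∧ μ (frontier B) = 0

/-- The topology on the space of currents with corners, for which the sets
`{ν | ∀ B ∈ 𝓑, |μ B - ν B| < ε}`, for finite collections `𝓑` of `μ`-admissible segmented flow boxes
and `ε > 0`, form a basis of neighbourhoods of `μ`. -/
instance (S : ClosedHyperbolicSurface) : TopologicalSpace (CurrentWithCorners S) :=
  TopologicalSpace.mkOfNhds fun μ =>
    ⨅ (𝓑 : Set (Set GeodesicSegments)) (_ : 𝓑.Finite ∧ ∀ B ∈ 𝓑, IsAdmissible μ.1 B)
      (ε : ℝ) (_ : 0 < ε),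
      𝓟 {ν : CurrentWithCorners S | ∀ B ∈ 𝓑, |μ.1.real B - ν.1.real B| < ε}

instance (S : ClosedHyperbolicSurface) : TopologicalSpace (GeodesicCurrent S) :=
  weakStarTopology S.deck Geodesics actGeodesics

instance (S : ClosedHyperbolicSurface) : TopologicalSpace (CenteredCurrentWithCorners S) :=
  weakStarTopology S.deck CenteredSegments actCentered

/-- The measure on geodesic segments that is carried by the bi-infinite geodesics and is equal to
`μ` there. -/
def toSegments (μ : Measure Geodesics) : Measure GeodesicSegments :=
  μ.map geodesicToSegment

/-- The measure on centered segments that is carried by the bi-infinite geodesics, is equal to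
`μ` transversally, and to hyperbolic arclength in the position of the center on the geodesic:
`A ↦ ∫ γ, (arclengthMeasure γ) A ∂μ`. -/
def toCentered (μ : Measure Geodesics) : Measure CenteredSegments :=
  μ.bind arclengthMeasure

end CurrentsWithCorners

end

/-!
Both maps are instances of one duality principle, `exists_isClosedEmbedding_of_dual`. Suppose that
a linear map `I` from test functions on `Y` to test functions on `X` is surjective and lifts
non-negative functions to non-negative functions. Then the dual map from Radon measures on `X` to
Radon measures on `Y` is a closed embedding for the weak-* topologies. It is an embedding because
every test function on `X` is of the form `I φ`. Its image is closed because it consists of the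
measures that annihilate the kernel of `I`: such a measure induces a positive functional on the
test functions on `X`, which is a measure by the theorem of Riesz, Markov and Kakutani. Compatibility
with the group action then only uses that the dual map is injective and equivariant.

For geodesic segments, `I` is the restriction of test functions to the closed subspace of
bi-infinite geodesics, and lifts exist by Tietze's theorem. What remains is that the topology given
by segmented flow boxes is the weak-* topology
(`currentWithCorners_topology_eq_weakStar`). Measures of admissible boxes are weak-* continuous at
`μ`, since the indicator function of such a box lies between test functions with almost the same
`μ`-integral (`integralTendsto_indicator`). Conversely, with the maximum norm on `ℂ × ℂ`, flow boxes
with two equal radii are balls, and the covering theorem of Besicovitch fills a flow box up to small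
`μ`-measure with finitely many disjoint small admissible ones (`exists_finset_flowBox`). Convergence
of the measures of these boxes and of the large box controls the integral of every test function
that is supported in the large box, and a partition of unity gives the general case.

For centered segments, `I` integrates a test function along every bi-infinite geodesic. Hopf
coordinates (`hopfHomeomorph`) identify the unit tangent bundle with the oriented geodesics times the
line. So the centered bi-infinite segments are the quotient of this product by the change of
orientation `(ξ, η, t) ↦ (η, ξ, -t)`, and they form the closed image of a proper map
(`isProperMap_hopfCentered`). A lift of `f` under `I` is an extension of `f(ξ, η) β(t)`, with `β` an
even bump function of integral `1`. Isometries act on the arclength parameter of a geodesic by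
translations (`exists_actCentered_hopfCentered`), which preserve arclength.
-/

noncomputable section

namespace CurrentsWithCorners

open Complex (UnitDisc UnitClosedDisc)

/-! ### Quotients by an involution -/

/-- `π` is the quotient map of a topological space by the group of order two that is generated by
the continuous involution `σ`. -/
structure IsInvolutionQuotient {Y Z : Type*} [TopologicalSpace Y] [TopologicalSpace Z]
    (π : Y → Z) (σ : Y → Y) : Prop where
  isQuotientMap : IsQuotientMap π
  continuous_inv : Continuous σ
  involutive : Function.Involutive σ
  eq_iff : ∀ p q, π p = π q ↔ q = p ∨ q = σ p

namespace IsInvolutionQuotient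

variable {Y Z : Type*} [TopologicalSpace Y] [TopologicalSpace Z] {π : Y → Z} {σ : Y → Y}

theorem preimage_image (h : IsInvolutionQuotient π σ) (C : Set Y) :
    π ⁻¹' (π '' C) = C ∪ σ ⁻¹' C := by
  ext p
  simp only [Set.mem_preimage, Set.mem_image, Set.mem_union]
  constructor
  · rintro ⟨q, hq, hqp⟩
    rcases (h.eq_iff q p).1 hqp with rfl | rfl
    · exact Or.inl hq
    · right
      rwa [h.involutive q]
  · rintro (hp | hp)
    · exact ⟨p, hp, rfl⟩
    · exact ⟨σ p, hp, ((h.eq_iff p (σ p)).2 (Or.inr rfl)).symm⟩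

theorem isOpenQuotientMap (h : IsInvolutionQuotient π σ) : IsOpenQuotientMap π := by
  refine ⟨h.isQuotientMap.surjective, h.isQuotientMap.continuous, fun U hU => ?_⟩
  rw [← h.isQuotientMap.isOpen_preimage, h.preimage_image]
  exact hU.union (hU.preimage h.continuous_inv)

theorem isClosedMap (h : IsInvolutionQuotient π σ) : IsClosedMap π := by
  intro C hC
  rw [← h.isQuotientMap.isClosed_preimage, h.preimage_image]
  exact hC.union (hC.preimage h.continuous_inv)

theorem isProperMap (h : IsInvolutionQuotient π σ) : IsProperMap π := by
  rw [isProperMap_iff_isClosedMap_and_compact_fibers]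
  refine ⟨h.isQuotientMap.continuous, h.isClosedMap, fun z => ?_⟩
  obtain ⟨p, rfl⟩ := h.isQuotientMap.surjective z
  refine Set.Finite.isCompact (((Set.finite_singleton (σ p)).insert p).subset fun q hq => ?_)
  simpa using (h.eq_iff p q).1 (Eq.symm hq)

theorem t2Space [T2Space Y] (h : IsInvolutionQuotient π σ) : T2Space Z := by
  rw [t2Space_iff_of_isOpenQuotientMap h.isOpenQuotientMap]
  simp only [h.eq_iff]
  exact (isClosed_eq continuous_snd continuous_fst).union
    (isClosed_eq continuous_snd (h.continuous_inv.comp continuous_fst))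

theorem secondCountableTopology [SecondCountableTopology Y] (h : IsInvolutionQuotient π σ) :
    SecondCountableTopology Z :=
  h.isQuotientMap.secondCountableTopology h.isOpenQuotientMap.isOpenMap

end IsInvolutionQuotient

/-! ### Extension of compactly supported functions -/

/-- A compactly supported function that is constant on the fibres of a proper map `p` descends to
the closed range of `p`, and by Tietze's theorem it is the restriction of a compactly supported
function. -/
theorem exists_comp_eq_of_isProperMap {H Z : Type*} [TopologicalSpace H] [TopologicalSpace Z]
    [T2Space Z] [LocallyCompactSpace Z] [NormalSpace Z] {p : H → Z} (hp : IsProperMap p)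
    (k : C_c(H, ℝ)) (hk : ∀ a b, p a = p b → k a = k b) :
    ∃ φ : C_c(Z, ℝ), (∀ a, φ (p a) = k a) ∧ ((∀ a, 0 ≤ k a) → ∀ z, 0 ≤ φ z) := by
  have hq : IsQuotientMap (Set.rangeFactorization p) := by
    refine IsClosedMap.isQuotientMap ?_ ?_ Set.rangeFactorization_surjective
    · exact hp.isClosedMap.subtype_mk _
    · exact hp.continuous.subtype_mk _
  let q : C(H, Set.range p) := ⟨Set.rangeFactorization p, hp.continuous.subtype_mk _⟩
  let k₀ : C(H, ℝ) := ⟨k, k.continuous⟩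
  have hfac : Function.FactorsThrough k₀ q := fun a b hab => hk a b (congrArg Subtype.val hab)
  let k' : C(Set.range p, ℝ) := hq.lift (f := q) k₀ hfac
  have hk' : ∀ a, k' (Set.rangeFactorization p a) = k a := fun a =>
    DFunLike.congr_fun (hq.lift_comp (f := q) k₀ hfac) a
  obtain ⟨g, hg⟩ := ContinuousMap.exists_restrict_eq hp.isClosedMap.isClosed_range k'
  have hcomp : IsCompact (p '' tsupport k) := k.hasCompactSupport.isCompact.image hp.continuous
  obtain ⟨χ, hχ1, -, hχc, hχ⟩ :=
    exists_continuous_one_zero_of_isCompact hcomp isClosed_empty (Set.disjoint_empty _)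
  have hval : ∀ a, χ (p a) * g (p a) = k a := by
    intro a
    have h1 : g (p a) = k a := by
      rw [← hk' a, ← hg]
      rfl
    rw [h1]
    by_cases ha : a ∈ tsupport k
    · rw [hχ1 ⟨a, ha, rfl⟩]
      simp
    · rw [image_eq_zero_of_notMem_tsupport ha, mul_zero]
  by_cases hpos : ∀ a, 0 ≤ k a
  · refine ⟨⟨⟨fun z => χ z * max (g z) 0, by fun_prop⟩, hχc.mul_right⟩, fun a => ?_,
      fun _ z => mul_nonneg (hχ z).1 (le_max_right _ _)⟩
    have h2 := hval a
    have h3 := mul_max_of_nonneg (g (p a)) 0 (hχ (p a)).1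
    rw [h2, mul_zero, max_eq_left (hpos a)] at h3
    exact h3
  · exact ⟨⟨⟨fun z => χ z * g z, by fun_prop⟩, hχc.mul_right⟩, hval, fun h => absurd h hpos⟩

/-! ### Duality for weak-* topologies -/

theorem continuous_integral_weakStar (Γ : Subgroup SU11) {Y : Type} [TopologicalSpace Y]
    [MeasurableSpace Y] (act : SU11 → Y → Y) (f : C_c(Y, ℝ)) :
    @Continuous _ _ (weakStarTopology Γ Y act) _
      fun μ : InvariantRadonMeasure Γ Y act => ∫ y, f y ∂μ.1 := by
  let := weakStarTopology Γ Y act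
  exact (continuous_apply f).comp (continuous_induced_dom
    (f := fun (μ : InvariantRadonMeasure Γ Y act) (f : C_c(Y, ℝ)) => ∫ y, f y ∂μ.1))

/-- Let `I` be a linear map from the test functions on `Y` to those on `X`, and let `T` be the dual
map from measures on `X` to measures on `Y`. If `I` is surjective and non-negative functions have
non-negative preimages, then `T` is a closed embedding for the weak-* topologies: the functionals
in its image are those that vanish on the kernel of `I`, because such a functional descends to a
positive functional on the test functions on `X`, which is a measure by the theorem of Riesz,
Markov and Kakutani. -/
theorem exists_isClosedEmbedding_of_dual {Γ : Subgroup SU11} {X Y : Type}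
    [TopologicalSpace X] [T2Space X] [LocallyCompactSpace X] [MeasurableSpace X] [BorelSpace X]
    [TopologicalSpace Y] [T2Space Y] [LocallyCompactSpace Y] [MeasurableSpace Y] [BorelSpace Y]
    {actX : SU11 → X → X} {actY : SU11 → Y → Y}
    (T : Measure X → Measure Y) (I : C_c(Y, ℝ) →ₗ[ℝ] C_c(X, ℝ))
    (hreg : ∀ μ : Measure X, μ.Regular → (T μ).Regular)
    (hint : ∀ μ : Measure X, μ.Regular → ∀ φ : C_c(Y, ℝ), ∫ y, φ y ∂T μ = ∫ x, I φ x ∂μ)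
    (hact : ∀ g ∈ Γ, ∀ μ : Measure X, μ.Regular → (μ.map (actX g)).Regular)
    (hequiv : ∀ g ∈ Γ, ∀ μ : Measure X, μ.Regular → T (μ.map (actX g)) = (T μ).map (actY g))
    (hlift : ∀ f : C_c(X, ℝ), ∃ φ, I φ = f ∧ ((∀ x, 0 ≤ f x) → ∀ y, 0 ≤ φ y)) :
    ∃ F : InvariantRadonMeasure Γ X actX → InvariantRadonMeasure Γ Y actY,
      (∀ μ, (F μ).1 = T μ.1) ∧
      @IsClosedEmbedding _ _ (weakStarTopology Γ X actX) (weakStarTopology Γ Y actY) F := by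
  let := weakStarTopology Γ X actX
  let := weakStarTopology Γ Y actY
  have hcontX : ∀ f : C_c(X, ℝ),
      Continuous fun μ : InvariantRadonMeasure Γ X actX => ∫ x, f x ∂μ.1 :=
    continuous_integral_weakStar Γ actX
  have hcontY : ∀ φ : C_c(Y, ℝ),
      Continuous fun ν : InvariantRadonMeasure Γ Y actY => ∫ y, φ y ∂ν.1 :=
    continuous_integral_weakStar Γ actY
  have hinj : ∀ μ μ' : Measure X, μ.Regular → μ'.Regular → T μ = T μ' → μ = μ' := by
    intro μ μ' hμ hμ' h
    refine Measure.ext_of_integral_eq_on_compactlySupported fun f => ?_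
    obtain ⟨φ, rfl, -⟩ := hlift f
    rw [← hint μ hμ, ← hint μ' hμ', h]
  let F : InvariantRadonMeasure Γ X actX → InvariantRadonMeasure Γ Y actY := fun μ =>
    ⟨T μ.1, hreg _ μ.2.1, fun g hg => by rw [← hequiv g hg _ μ.2.1, μ.2.2 g hg]⟩
  have hF : ∀ (φ : C_c(Y, ℝ)) (μ : InvariantRadonMeasure Γ X actX),
      ∫ x, I φ x ∂μ.1 = ∫ y, φ y ∂(F μ).1 := fun φ μ => (hint _ μ.2.1 φ).symm
  refine ⟨F, fun _ => rfl, ⟨⟨⟨?_⟩, ?_⟩, ?_⟩⟩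
  · apply le_antisymm
    · refine continuous_iff_le_induced.1 (continuous_induced_rng.2 (continuous_pi fun φ => ?_))
      exact (hcontX (I φ)).congr (hF φ)
    · let t : TopologicalSpace (InvariantRadonMeasure Γ X actX) :=
        (weakStarTopology Γ Y actY).induced F
      refine continuous_iff_le_induced.1 (@continuous_pi _ _ _ t _ _ fun f => ?_)
      obtain ⟨φ, rfl, -⟩ := hlift f
      have hc : @Continuous _ _ t _ fun μ => ∫ y, φ y ∂(F μ).1 :=
        (hcontY φ).comp continuous_induced_dom
      exact @Continuous.congr _ _ t _ _ _ hc fun μ => (hF φ μ).symm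
  · intro μ μ' h
    exact Subtype.ext (hinj _ _ μ.2.1 μ'.2.1 (congrArg Subtype.val h))
  · have hrange : Set.range F = ⋂ φ ∈ {φ : C_c(Y, ℝ) | I φ = 0},
        {ν : InvariantRadonMeasure Γ Y actY | ∫ y, φ y ∂ν.1 = 0} := by
      ext ν
      simp only [Set.mem_range, Set.mem_iInter, Set.mem_ofPred_eq]
      constructor
      · rintro ⟨μ, rfl⟩ φ hφ
        rw [← hF, hφ]
        simp
      · intro hν
        have := ν.2.1
        -- the functional of `ν` takes the same value on all preimages of a function under `I`
        let N := CompactlySupportedContinuousMap.integralPositiveLinearMap ν.1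
        have hN : ∀ φ : C_c(Y, ℝ), N φ = ∫ y, φ y ∂ν.1 := fun φ => rfl
        have hker : ∀ φ ψ : C_c(Y, ℝ), I φ = I ψ → N φ = N ψ := by
          intro φ ψ h
          rw [← sub_eq_zero, ← map_sub, hN]
          exact hν _ (by rw [map_sub, h, sub_self])
        choose L hL hLpos using hlift
        let Λ₀ : C_c(X, ℝ) →ₗ[ℝ] ℝ :=
          { toFun := fun f => N (L f)
            map_add' := fun f f' => by
              rw [← map_add]
              exact hker _ _ (by rw [map_add, hL, hL, hL])
            map_smul' := fun c f => by
              rw [RingHom.id_apply, ← map_smul]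
              exact hker _ _ (by rw [map_smul, hL, hL]) }
        let Λ : C_c(X, ℝ) →ₚ[ℝ] ℝ := PositiveLinearMap.mk₀ Λ₀ fun f hf =>
          integral_nonneg (hLpos f hf)
        have hΛ : ∀ f, ∫ x, f x ∂(RealRMK.rieszMeasure Λ) = N (L f) := fun f =>
          RealRMK.integral_rieszMeasure Λ f
        have hμ : (RealRMK.rieszMeasure Λ).Regular := inferInstance
        have hTμ : T (RealRMK.rieszMeasure Λ) = ν.1 := by
          have := hreg _ hμ
          refine Measure.ext_of_integral_eq_on_compactlySupported fun φ => ?_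
          rw [hint _ hμ, hΛ]
          exact hker _ _ (hL _)
        refine ⟨⟨RealRMK.rieszMeasure Λ, hμ, fun g hg => ?_⟩, Subtype.ext hTμ⟩
        refine hinj _ _ (hact g hg _ hμ) hμ ?_
        rw [hequiv g hg _ hμ, hTμ, ν.2.2 g hg]
    rw [hrange]
    exact isClosed_biInter fun φ _ => isClosed_eq (hcontY φ) continuous_const

/-! ### Topology of the discs, of unordered pairs and of centered segments -/

instance : T2Space UnitDisc := UnitDisc.isEmbedding_coe.t2Space

instance : SecondCountableTopology UnitDisc :=
  UnitDisc.isEmbedding_coe.secondCountableTopology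

instance : LocallyCompactSpace UnitDisc :=
  Metric.isOpen_ball.locallyCompactSpace (s := Metric.ball (0 : ℂ) 1)

instance : T2Space UnitClosedDisc := UnitClosedDisc.isEmbedding_coe.t2Space

instance : SecondCountableTopology UnitClosedDisc :=
  UnitClosedDisc.isEmbedding_coe.secondCountableTopology

instance : CompactSpace UnitClosedDisc :=
  inferInstanceAs (CompactSpace (Metric.closedBall (0 : ℂ) 1))

/-- The space of ordered pairs of distinct points of `X`. -/
abbrev OrderedPair (X : Type) : Type := {p : X × X // p.1 ≠ p.2}

/-- The map that exchanges the entries of an ordered pair. -/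
def OrderedPair.swap {X : Type} (p : OrderedPair X) : OrderedPair X := ⟨p.1.swap, p.2.symm⟩

/-- The map that forgets the order of a pair. -/
def OrderedPair.toUnordered {X : Type} (p : OrderedPair X) : UnorderedPair X :=
  UnorderedPair.mk p.1.1 p.1.2 p.2

theorem OrderedPair.isInvolutionQuotient_toUnordered (X : Type) [TopologicalSpace X] :
    IsInvolutionQuotient (toUnordered : OrderedPair X → UnorderedPair X) swap where
  isQuotientMap := isQuotientMap_quot_mk
  continuous_inv := (continuous_swap.comp continuous_subtype_val).subtype_mk _
  involutive _ := Subtype.ext (Prod.swap_swap _)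
  eq_iff p q := by
    refine (Quotient.eq (r := swapSetoid X)).trans ?_
    rw [Subtype.ext_iff, Subtype.ext_iff]
    rfl

theorem UnorderedPair.ind {X : Type} {P : UnorderedPair X → Prop}
    (h : ∀ p : OrderedPair X, P p.toUnordered) (γ : UnorderedPair X) : P γ :=
  Quotient.ind h γ

theorem UnorderedPair.mk_eq_mk_iff {X : Type} {x y x' y' : X} {h : x ≠ y} {h' : x' ≠ y'} :
    UnorderedPair.mk x y h = UnorderedPair.mk x' y' h' ↔
      (x' = x ∧ y' = y) ∨ (x' = y ∧ y' = x) := by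
  refine (Quotient.eq (r := swapSetoid X)).trans ?_
  change (x', y') = (x, y) ∨ (x', y') = (y, x) ↔ _
  simp only [Prod.mk.injEq]

theorem isOpen_ne_pair (X : Type) [TopologicalSpace X] [T2Space X] :
    IsOpen {p : X × X | p.1 ≠ p.2} :=
  isOpen_ne_fun continuous_fst continuous_snd

instance (X : Type) [TopologicalSpace X] [T2Space X] [LocallyCompactSpace X] :
    LocallyCompactSpace (OrderedPair X) :=
  (isOpen_ne_pair X).locallyCompactSpace

instance (X : Type) [TopologicalSpace X] [SecondCountableTopology X] :
    SecondCountableTopology (OrderedPair X) :=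
  TopologicalSpace.Subtype.secondCountableTopology {p : X × X | p.1 ≠ p.2}

instance (X : Type) [TopologicalSpace X] [T2Space X] : T2Space (UnorderedPair X) :=
  (OrderedPair.isInvolutionQuotient_toUnordered X).t2Space

instance (X : Type) [TopologicalSpace X] [SecondCountableTopology X] :
    SecondCountableTopology (UnorderedPair X) :=
  (OrderedPair.isInvolutionQuotient_toUnordered X).secondCountableTopology

instance (X : Type) [TopologicalSpace X] [T2Space X] [LocallyCompactSpace X] :
    LocallyCompactSpace (UnorderedPair X) :=
  (OrderedPair.isInvolutionQuotient_toUnordered X).isOpenQuotientMap.locallyCompactSpace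

/-- The antipodal map of the fibres of the compactified tangent bundle. -/
def fibreNeg (p : UnitDisc × UnitClosedDisc) : UnitDisc × UnitClosedDisc := (p.1, -p.2)

theorem isInvolutionQuotient_centeredMk :
    IsInvolutionQuotient (fun p : UnitDisc × UnitClosedDisc => CenteredSegments.mk p.1 p.2)
      fibreNeg where
  isQuotientMap := isQuotientMap_quot_mk
  continuous_inv := by
    have h : Continuous fun w : UnitClosedDisc => -w := by
      rw [UnitClosedDisc.isEmbedding_coe.continuous_iff]
      exact UnitClosedDisc.continuous_coe.neg
    exact continuous_fst.prodMk (h.comp continuous_snd)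
  involutive p := by simp [fibreNeg]
  eq_iff _ _ := Quotient.eq (r := antipodalSetoid)

instance : T2Space CenteredSegments := isInvolutionQuotient_centeredMk.t2Space

instance : SecondCountableTopology CenteredSegments :=
  isInvolutionQuotient_centeredMk.secondCountableTopology

instance : LocallyCompactSpace CenteredSegments :=
  isInvolutionQuotient_centeredMk.isOpenQuotientMap.locallyCompactSpace

theorem regular_of_isCompact_lt_top {X : Type*} [TopologicalSpace X] [T2Space X]
    [LocallyCompactSpace X] [SecondCountableTopology X] [MeasurableSpace X] [BorelSpace X]
    {μ : Measure X} (h : ∀ K, IsCompact K → μ K < ⊤) : μ.Regular := by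
  have : IsFiniteMeasureOnCompacts μ := ⟨fun {K} hK => h K hK⟩
  have : IsLocallyFiniteMeasure μ := isLocallyFiniteMeasure_of_isFiniteMeasureOnCompacts
  infer_instance

theorem UnorderedPair.continuous_map {X Y : Type} [TopologicalSpace X] [TopologicalSpace Y]
    {f : X → Y} (hf : Function.Injective f) (hc : Continuous f) :
    Continuous (UnorderedPair.map f hf) := by
  rw [(OrderedPair.isInvolutionQuotient_toUnordered X).isQuotientMap.continuous_iff]
  refine (OrderedPair.isInvolutionQuotient_toUnordered Y).isQuotientMap.continuous.comp
    (f := fun p : OrderedPair X => (⟨(f p.1.1, f p.1.2), fun h => p.2 (hf h)⟩ : OrderedPair Y)) ?_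
  exact Continuous.subtype_mk (by fun_prop) _

/-! ### Continuity and invertibility of the actions -/

theorem continuous_circle_coe : Continuous fun z : Circle => (z : ℂ) :=
  continuous_subtype_val

theorem SU11.continuousOn_mobius (g : SU11) : ContinuousOn g.mobius {z | ‖z‖ ≤ 1} :=
  ContinuousOn.div (by fun_prop) (by fun_prop) fun _ hz => den_ne_zero g.norm_b_lt hz

theorem SU11.continuous_onDisc (g : SU11) : Continuous g.onDisc := by
  rw [UnitDisc.isEmbedding_coe.continuous_iff]
  exact g.continuousOn_mobius.comp_continuous UnitDisc.continuous_coe fun z => z.norm_lt_one.le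

theorem SU11.continuous_onClosedDisc (g : SU11) : Continuous g.onClosedDisc := by
  rw [UnitClosedDisc.isEmbedding_coe.continuous_iff]
  exact g.continuousOn_mobius.comp_continuous UnitClosedDisc.continuous_coe
    fun z => z.norm_le_one

theorem SU11.continuous_onCircle (g : SU11) : Continuous g.onCircle :=
  (g.continuousOn_mobius.comp_continuous continuous_circle_coe
    fun z => z.norm_coe.le).subtype_mk _

theorem SU11.continuous_unitDeriv (g : SU11) : Continuous g.unitDeriv := by
  have h : Continuous fun x : UnitDisc => conj g.b * (x : ℂ) + conj g.a := by
    have := UnitDisc.continuous_coe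
    fun_prop
  exact ((Complex.continuous_conj.comp h).div h
    fun x => den_ne_zero g.norm_b_lt x.norm_lt_one.le).subtype_mk _

theorem continuous_actSegments (g : SU11) : Continuous (actSegments g) :=
  UnorderedPair.continuous_map _ g.continuous_onClosedDisc

theorem continuous_actGeodesics (g : SU11) : Continuous (actGeodesics g) :=
  UnorderedPair.continuous_map _ g.continuous_onCircle

theorem continuous_circle_smul_closedDisc :
    Continuous fun p : Circle × UnitClosedDisc => p.1 • p.2 := by
  rw [UnitClosedDisc.isEmbedding_coe.continuous_iff]
  exact (continuous_circle_coe.comp continuous_fst).mul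
    (UnitClosedDisc.continuous_coe.comp continuous_snd)

theorem continuous_actCentered (g : SU11) : Continuous (actCentered g) := by
  rw [isInvolutionQuotient_centeredMk.isQuotientMap.continuous_iff]
  refine isInvolutionQuotient_centeredMk.isQuotientMap.continuous.comp
    (f := fun p : UnitDisc × UnitClosedDisc => (g.onDisc p.1, g.unitDeriv p.1 • p.2)) ?_
  exact (g.continuous_onDisc.comp continuous_fst).prodMk (continuous_circle_smul_closedDisc.comp
    ((g.continuous_unitDeriv.comp continuous_fst).prodMk continuous_snd))

theorem SU11.mobius_inv_mobius (g : SU11) {z : ℂ} (hz : ‖z‖ ≤ 1) :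
    g⁻¹.mobius (g.mobius z) = z := by
  have ha : g⁻¹.a = conj g.a := by
    change (g.1⁻¹) 0 0 = _
    rw [Matrix.SpecialLinearGroup.SL2_inv_expl]
    exact g.2.2
  have hb : g⁻¹.b = -g.b := by
    change (g.1⁻¹) 0 1 = _
    rw [Matrix.SpecialLinearGroup.SL2_inv_expl]
    rfl
  have hd := den_ne_zero g.norm_b_lt hz
  have hdet := g.det_eq
  unfold SU11.mobius
  rw [ha, hb, map_neg, Complex.conj_conj]
  have h1 : -conj g.b * ((g.a * z + g.b) / (conj g.b * z + conj g.a)) + g.a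
      = 1 / (conj g.b * z + conj g.a) := by
    field_simp
    linear_combination hdet
  rw [h1, div_div_eq_mul_div, div_one, add_mul, mul_assoc, div_mul_cancel₀ _ hd]
  linear_combination z * hdet

theorem actGeodesics_inv_actGeodesics (g : SU11) (γ : Geodesics) :
    actGeodesics g⁻¹ (actGeodesics g γ) = γ := by
  induction γ using UnorderedPair.ind with | h p
  have h : ∀ z, g⁻¹.onCircle (g.onCircle z) = z := fun z =>
    Circle.ext (g.mobius_inv_mobius z.norm_coe.le)
  refine UnorderedPair.mk_eq_mk_iff.2 (Or.inl ?_)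
  simp only [h, and_self]

/-- The action of an isometry on bi-infinite geodesics, as a homeomorphism. -/
def actGeodesicsHomeomorph (g : SU11) : Geodesics ≃ₜ Geodesics where
  toFun := actGeodesics g
  invFun := actGeodesics g⁻¹
  left_inv := actGeodesics_inv_actGeodesics g
  right_inv γ := by simpa using actGeodesics_inv_actGeodesics g⁻¹ γ
  continuous_toFun := continuous_actGeodesics g
  continuous_invFun := continuous_actGeodesics g⁻¹

theorem regular_map_actGeodesics (g : SU11) (μ : Measure Geodesics) (hμ : μ.Regular) :
    (μ.map (actGeodesics g)).Regular :=
  Measure.Regular.map (actGeodesicsHomeomorph g)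

/-! ### Convergence of integrals -/

/-- The function `h` is integrable for all the measures, and its integral for `ν i` tends to its
integral for `μ`. -/
def IntegralTendsto {ι X : Type*} [MeasurableSpace X] (l : Filter ι) (ν : ι → Measure X)
    (μ : Measure X) (h : X → ℝ) : Prop :=
  (∀ i, Integrable h (ν i)) ∧ Integrable h μ ∧
    Tendsto (fun i => ∫ x, h x ∂ν i) l (𝓝 (∫ x, h x ∂μ))

namespace IntegralTendsto

variable {ι X : Type*} [MeasurableSpace X] {l : Filter ι} {ν : ι → Measure X} {μ : Measure X}
  {h k : X → ℝ}

theorem add (hh : IntegralTendsto l ν μ h) (hk : IntegralTendsto l ν μ k) :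
    IntegralTendsto l ν μ (fun x => h x + k x) := by
  refine ⟨fun i => (hh.1 i).add (hk.1 i), hh.2.1.add hk.2.1, ?_⟩
  rw [integral_add hh.2.1 hk.2.1]
  refine (hh.2.2.add hk.2.2).congr fun i => ?_
  rw [integral_add (hh.1 i) (hk.1 i)]

theorem const_mul (hh : IntegralTendsto l ν μ h) (c : ℝ) :
    IntegralTendsto l ν μ (fun x => c * h x) := by
  refine ⟨fun i => (hh.1 i).const_mul c, hh.2.1.const_mul c, ?_⟩
  simp only [integral_const_mul]
  exact hh.2.2.const_mul c

theorem sub (hh : IntegralTendsto l ν μ h) (hk : IntegralTendsto l ν μ k) :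
    IntegralTendsto l ν μ (fun x => h x - k x) := by
  simpa [sub_eq_add_neg] using hh.add (hk.const_mul (-1))

theorem sum {κ : Type*} (s : Finset κ) {H : κ → X → ℝ}
    (hH : ∀ j ∈ s, IntegralTendsto l ν μ (H j)) :
    IntegralTendsto l ν μ (fun x => ∑ j ∈ s, H j x) := by
  refine ⟨fun i => integrable_finsetSum _ fun j hj => (hH j hj).1 i,
    integrable_finsetSum _ fun j hj => (hH j hj).2.1, ?_⟩
  rw [integral_finsetSum _ fun j hj => (hH j hj).2.1]
  refine (tendsto_finsetSum _ fun j hj => (hH j hj).2.2).congr fun i => ?_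
  rw [integral_finsetSum _ fun j hj => (hH j hj).1 i]

/-- Convergence of integrals passes to functions that are approximated, up to an error function of
small integral, by functions whose integrals converge. -/
theorem of_sandwich {f : X → ℝ} (hν : ∀ i, Integrable f (ν i)) (hμ : Integrable f μ)
    (H : ∀ ε > 0, ∃ h e, IntegralTendsto l ν μ h ∧ IntegralTendsto l ν μ e ∧
      (∀ x, |f x - h x| ≤ e x) ∧ ∫ x, e x ∂μ < ε) : IntegralTendsto l ν μ f := by
  refine ⟨hν, hμ, Metric.tendsto_nhds.2 fun ε hε => ?_⟩
  obtain ⟨h, e, hh, he, hfe, heε⟩ := H (ε / 4) (by positivity)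
  have key : ∀ m : Measure X, Integrable f m → Integrable h m → Integrable e m →
      |∫ x, f x ∂m - ∫ x, h x ∂m| ≤ ∫ x, e x ∂m := by
    intro m h1 h2 h3
    rw [← integral_sub h1 h2]
    exact (abs_integral_le_integral_abs).trans (integral_mono (h1.sub h2).abs h3 hfe)
  have k0 := abs_le.1 (key μ hμ hh.2.1 he.2.1)
  filter_upwards [Metric.tendsto_nhds.1 hh.2.2 (ε / 4) (by positivity),
    he.2.2.eventually_lt_const heε] with i h1 h2
  have k1 := abs_le.1 (key (ν i) (hν i) (hh.1 i) (he.1 i))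
  rw [Real.dist_eq] at h1 ⊢
  have k2 := abs_lt.1 h1
  rw [abs_lt]
  constructor <;> linarith

end IntegralTendsto

theorem integrable_indicator_one {X : Type*} [MeasurableSpace X] {μ : Measure X} {B : Set X}
    (hB : MeasurableSet B) (hμ : μ B ≠ ⊤) : Integrable (B.indicator fun _ => (1 : ℝ)) μ :=
  (integrable_indicator_iff hB).2 (integrableOn_const hμ)

/-- If integrals of test functions converge, so do the measures of relatively compact open sets
with a boundary of measure `0`. -/
theorem integralTendsto_indicator {ι X : Type*} [TopologicalSpace X] [T2Space X]
    [LocallyCompactSpace X] [MeasurableSpace X] [BorelSpace X] {l : Filter ι}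
    {ν : ι → Measure X} {μ : Measure X} (hν : ∀ i, (ν i).Regular) (hμ : μ.Regular)
    (H : ∀ f : C_c(X, ℝ), IntegralTendsto l ν μ f) {B : Set X} (hB : IsOpen B)
    (hc : IsCompact (closure B)) (hfr : μ (frontier B) = 0) :
    IntegralTendsto l ν μ (B.indicator fun _ => (1 : ℝ)) := by
  have hfin : ∀ m : Measure X, m.Regular → m B ≠ ⊤ := fun m _ =>
    ((measure_mono subset_closure).trans_lt hc.measure_lt_top).ne
  refine IntegralTendsto.of_sandwich
    (fun i => integrable_indicator_one hB.measurableSet (hfin _ (hν i)))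
    (integrable_indicator_one hB.measurableSet (hfin _ hμ)) fun ε hε => ?_
  have hcl : μ (closure B) = μ B := by
    refine le_antisymm ?_ (measure_mono subset_closure)
    calc μ (closure B) ≤ μ (B ∪ frontier B) := measure_mono (by
          rw [hB.frontier_eq, Set.union_sdiff_self]
          exact Set.subset_union_right)
      _ ≤ μ B + μ (frontier B) := measure_union_le _ _
      _ = μ B := by rw [hfr, add_zero]
  obtain ⟨V, hVB, hV, hVμ⟩ := (closure B).exists_isOpen_lt_add (μ := μ)
    (hc.measure_lt_top.ne) (ε := ENNReal.ofReal (ε / 2)) (by simpa using hε)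
  obtain ⟨K, hKB, hK, hKμ⟩ := hB.measurableSet.exists_isCompact_lt_add (μ := μ) (hfin _ hμ)
    (ε := ENNReal.ofReal (ε / 2)) (by simpa using hε)
  rw [hcl] at hVμ
  have hVtop : μ V ≠ ⊤ := (hVμ.trans_le le_top).ne
  have hV' : μ.real V < μ.real B + ε / 2 := by
    have := (ENNReal.toReal_lt_toReal hVtop (by finiteness [hfin _ hμ])).2 hVμ
    rwa [ENNReal.toReal_add (hfin _ hμ) ENNReal.ofReal_ne_top,
      ENNReal.toReal_ofReal (by positivity)] at this
  have hK' : μ.real B < μ.real K + ε / 2 := by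
    have hKtop := hK.measure_lt_top (μ := μ).ne
    have := (ENNReal.toReal_lt_toReal (hfin _ hμ) (by finiteness [hKtop])).2 hKμ
    rwa [ENNReal.toReal_add hKtop ENNReal.ofReal_ne_top,
      ENNReal.toReal_ofReal (by positivity)] at this
  obtain ⟨f, hf1, hf0, hfc, hf⟩ := exists_continuous_one_zero_of_isCompact hK hB.isClosed_compl
    (Set.disjoint_compl_right_iff_subset.2 hKB)
  obtain ⟨g, hg1, hg0, hgc, hg⟩ := exists_continuous_one_zero_of_isCompact hc hV.isClosed_compl
    (Set.disjoint_compl_right_iff_subset.2 hVB)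
  have Hf : IntegralTendsto l ν μ f := H ⟨f, hfc⟩
  have Hg : IntegralTendsto l ν μ g := H ⟨g, hgc⟩
  refine ⟨f, fun x => g x - f x, Hf, Hg.sub Hf, fun x => ?_, ?_⟩
  · beta_reduce
    by_cases hx : x ∈ B
    · have h1 : g x = 1 := hg1 (subset_closure hx)
      rw [Set.indicator_of_mem hx, h1, abs_of_nonneg (by linarith [(hf x).2])]
    · have h0 : f x = 0 := hf0 hx
      rw [Set.indicator_of_notMem hx, h0, sub_zero, sub_zero, abs_zero]
      exact (hg x).1
  · have h1 : ∫ x, g x ∂μ ≤ μ.real V := by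
      rw [← integral_indicator_one hV.measurableSet]
      refine integral_mono Hg.2.1 (integrable_indicator_one hV.measurableSet hVtop) fun x => ?_
      by_cases hx : x ∈ V
      · simpa [hx] using (hg x).2
      · simpa [hx] using (hg0 hx).le
    have h2 : μ.real K ≤ ∫ x, f x ∂μ := by
      rw [← integral_indicator_one hK.measurableSet]
      refine integral_mono (integrable_indicator_one hK.measurableSet hK.measure_lt_top.ne)
        Hf.2.1 fun x => ?_
      by_cases hx : x ∈ K
      · simpa [hx] using (hf1 hx).ge
      · simpa [hx] using (hf x).1
    beta_reduce
    rw [integral_sub Hg.2.1 Hf.2.1]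
    linarith

/-! ### Flow boxes and balls in the product of two planes -/

/-- The pair of endpoints of an oriented segment, as a point of the product of two planes. With the
maximum norm on this product, the segmented flow boxes with two equal radii correspond to balls. -/
def endpoints (p : OrderedPair UnitClosedDisc) : ℂ × ℂ := (p.1.1, p.1.2)

theorem isEmbedding_endpoints : IsEmbedding endpoints :=
  (UnitClosedDisc.isEmbedding_coe.prodMap UnitClosedDisc.isEmbedding_coe).comp
    IsEmbedding.subtypeVal

theorem segmentedFlowBox_eq_image (x₁ x₂ : UnitClosedDisc) (ε₁ ε₂ : ℝ) :
    segmentedFlowBox x₁ x₂ ε₁ ε₂ = OrderedPair.toUnordered ''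
      (endpoints ⁻¹' (Metric.ball (x₁ : ℂ) ε₁ ×ˢ Metric.ball (x₂ : ℂ) ε₂)) := by
  ext γ
  simp only [segmentedFlowBox, endpoints, Set.mem_ofPred_eq, Set.mem_image, Set.mem_preimage,
    Set.mem_prod, mem_ball_iff_norm]
  constructor
  · rintro ⟨z, w, h, hz, hw, rfl⟩
    exact ⟨⟨(z, w), h⟩, ⟨hz, hw⟩, rfl⟩
  · rintro ⟨⟨⟨z, w⟩, h⟩, ⟨hz, hw⟩, rfl⟩
    exact ⟨z, w, h, hz, hw, rfl⟩

theorem isOpen_segmentedFlowBox (x₁ x₂ : UnitClosedDisc) (ε₁ ε₂ : ℝ) :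
    IsOpen (segmentedFlowBox x₁ x₂ ε₁ ε₂) := by
  rw [segmentedFlowBox_eq_image]
  exact (OrderedPair.isInvolutionQuotient_toUnordered _).isOpenQuotientMap.isOpenMap _
    ((Metric.isOpen_ball.prod Metric.isOpen_ball).preimage isEmbedding_endpoints.continuous)

theorem closure_segmentedFlowBox_subset (x₁ x₂ : UnitClosedDisc) (ε₁ ε₂ : ℝ) :
    closure (segmentedFlowBox x₁ x₂ ε₁ ε₂) ⊆ OrderedPair.toUnordered ''
      (endpoints ⁻¹' (Metric.closedBall (x₁ : ℂ) ε₁ ×ˢ Metric.closedBall (x₂ : ℂ) ε₂)) := by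
  rw [segmentedFlowBox_eq_image]
  refine closure_minimal (Set.image_mono (Set.preimage_mono
    (Set.prod_mono Metric.ball_subset_closedBall Metric.ball_subset_closedBall))) ?_
  exact (OrderedPair.isInvolutionQuotient_toUnordered _).isClosedMap _
    ((Metric.isClosed_closedBall.prod Metric.isClosed_closedBall).preimage
      isEmbedding_endpoints.continuous)

theorem IsSegmentedFlowBox.isOpen {B : Set GeodesicSegments} (hB : IsSegmentedFlowBox B) :
    IsOpen B := by
  obtain ⟨x₁, x₂, ε₁, ε₂, -, -, -, rfl⟩ := hB
  exact isOpen_segmentedFlowBox _ _ _ _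

theorem IsSegmentedFlowBox.isCompact_closure {B : Set GeodesicSegments}
    (hB : IsSegmentedFlowBox B) : IsCompact (closure B) := by
  obtain ⟨x₁, x₂, ε₁, ε₂, -, -, hd, rfl⟩ := hB
  refine IsCompact.of_isClosed_subset ?_ isClosed_closure (closure_segmentedFlowBox_subset _ _ _ _)
  refine IsCompact.image ?_ (OrderedPair.isInvolutionQuotient_toUnordered _).isQuotientMap.continuous
  -- the two closed discs are disjoint, so their product is a closed set of the compact square
  -- of the closed disc that misses the diagonal
  rw [IsEmbedding.subtypeVal.isCompact_iff]
  have h : (Subtype.val '' (endpoints ⁻¹' (Metric.closedBall (x₁ : ℂ) ε₁ ×ˢ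
      Metric.closedBall (x₂ : ℂ) ε₂)) : Set (UnitClosedDisc × UnitClosedDisc))
      = (fun p => ((p.1 : ℂ), (p.2 : ℂ))) ⁻¹' (Metric.closedBall (x₁ : ℂ) ε₁ ×ˢ
        Metric.closedBall (x₂ : ℂ) ε₂) := by
    ext p
    constructor
    · rintro ⟨q, hq, rfl⟩
      exact hq
    · intro hp
      exact ⟨⟨p, fun e => Set.disjoint_left.1 hd hp.1 (e ▸ hp.2 : (p.1 : ℂ) ∈ _)⟩, hp, rfl⟩
  rw [h]
  refine ((Metric.isClosed_closedBall.prod Metric.isClosed_closedBall).preimage ?_).isCompact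
  have := UnitClosedDisc.continuous_coe
  fun_prop

theorem IsSegmentedFlowBox.measure_ne_top {B : Set GeodesicSegments} (hB : IsSegmentedFlowBox B)
    (μ : Measure GeodesicSegments) [IsFiniteMeasureOnCompacts μ] : μ B ≠ ⊤ :=
  ((measure_mono subset_closure).trans_lt hB.isCompact_closure.measure_lt_top).ne

theorem injOn_toUnordered {D₁ D₂ : Set ℂ} (hd : Disjoint D₁ D₂) :
    Set.InjOn OrderedPair.toUnordered (endpoints ⁻¹' (D₁ ×ˢ D₂)) := by
  rintro p hp q hq h
  rcases ((OrderedPair.isInvolutionQuotient_toUnordered _).eq_iff p q).1 h with rfl | rfl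
  · rfl
  · exact (Set.disjoint_left.1 hd hp.1 hq.2).elim

/-- The restriction of `μ` to a flow box, transported to the product of two planes. -/
theorem exists_measure_endpoints (μ : Measure GeodesicSegments) {D₁ D₂ : Set ℂ}
    (h₁ : IsOpen D₁) (h₂ : IsOpen D₂) (hd : Disjoint D₁ D₂) :
    ∃ m : Measure (ℂ × ℂ), ∀ A, MeasurableSet A →
      m A = μ (OrderedPair.toUnordered '' (endpoints ⁻¹' (D₁ ×ˢ D₂ ∩ A))) := by
  borelize (OrderedPair UnitClosedDisc)
  let S : Set (OrderedPair UnitClosedDisc) := endpoints ⁻¹' (D₁ ×ˢ D₂)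
  have hS : IsOpen S := (h₁.prod h₂).preimage isEmbedding_endpoints.continuous
  have hj : IsOpenEmbedding (fun p : S => p.1.toUnordered) := by
    have hq := (OrderedPair.isInvolutionQuotient_toUnordered UnitClosedDisc).isOpenQuotientMap
    refine IsOpenEmbedding.of_continuous_injective_isOpenMap
      (hq.continuous.comp continuous_subtype_val) ?_
      (hq.isOpenMap.comp hS.isOpenEmbedding_subtypeVal.isOpenMap)
    intro p q h
    exact Subtype.ext (injOn_toUnordered hd p.2 q.2 h)
  have hc : Continuous fun p : S => endpoints p.1 :=
    isEmbedding_endpoints.continuous.comp continuous_subtype_val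
  refine ⟨(μ.comap fun p : S => p.1.toUnordered).map fun p => endpoints p.1, fun A hA => ?_⟩
  rw [Measure.map_apply hc.measurable hA, hj.measurableEmbedding.comap_apply]
  congr 1
  ext γ
  constructor
  · rintro ⟨p, hp, rfl⟩
    exact ⟨p.1, ⟨p.2, hp⟩, rfl⟩
  · rintro ⟨p, ⟨hp, hA⟩, rfl⟩
    exact ⟨⟨p, hp⟩, hA, rfl⟩

/-- All but countably many of the spheres about a point have measure `0`. -/
theorem exists_sphere_null {α : Type*} [PseudoMetricSpace α] [MeasurableSpace α]
    [OpensMeasurableSpace α] (m : Measure α) [SFinite m] (x : α) {δ : ℝ} (hδ : 0 < δ) :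
    ({r | m (Metric.sphere x r) = 0} ∩ Set.Ioo 0 δ).Nonempty := by
  have hcount : {r : ℝ | 0 < m (Metric.sphere x r)}.Countable :=
    Measure.countable_meas_pos_of_disjoint_iUnion
      (fun r => Metric.isClosed_sphere.measurableSet) fun r s hrs =>
        Set.disjoint_left.2 fun y hr hs => hrs (hr.symm.trans hs)
  by_contra hne
  refine (Cardinal.Real.Ioo_countable_iff.1
    (hcount.mono (s₁ := Set.Ioo 0 δ) fun r hr => ?_)).not_gt hδ
  exact pos_iff_ne_zero.2 fun h0 => hne ⟨r, h0, hr⟩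

/-! ### The flow box topology is the weak-* topology -/

/-- A ball about the endpoints of `p`, contained in a product of two disjoint discs and with a
sphere of measure `0`, comes from an admissible flow box. -/
theorem isAdmissible_of_sphere_null {μ : Measure GeodesicSegments} {D₁ D₂ : Set ℂ}
    (hd : Disjoint D₁ D₂) {m : Measure (ℂ × ℂ)}
    (hm : ∀ A, MeasurableSet A →
      m A = μ (OrderedPair.toUnordered '' (endpoints ⁻¹' (D₁ ×ˢ D₂ ∩ A))))
    (p : OrderedPair UnitClosedDisc) {r : ℝ} (hr : 0 < r)
    (hb : Metric.closedBall (endpoints p) r ⊆ D₁ ×ˢ D₂)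
    (hs : m (Metric.sphere (endpoints p) r) = 0) :
    IsAdmissible μ (segmentedFlowBox p.1.1 p.1.2 r r) ∧
      segmentedFlowBox p.1.1 p.1.2 r r
        = OrderedPair.toUnordered '' (endpoints ⁻¹' Metric.ball (endpoints p) r) ∧
      μ (segmentedFlowBox p.1.1 p.1.2 r r) = m (Metric.closedBall (endpoints p) r) := by
  have hbox : segmentedFlowBox p.1.1 p.1.2 r r
      = OrderedPair.toUnordered '' (endpoints ⁻¹' Metric.ball (endpoints p) r) := by
    rw [segmentedFlowBox_eq_image, ball_prod_same]
    rfl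
  have hb' : Metric.closedBall (p.1.1 : ℂ) r ×ˢ Metric.closedBall (p.1.2 : ℂ) r ⊆ D₁ ×ˢ D₂ := by
    rwa [closedBall_prod_same]
  refine ⟨⟨⟨p.1.1, p.1.2, r, r, hr, hr, ?_, rfl⟩, ?_⟩, hbox, ?_⟩
  · refine hd.mono (fun u hu => ?_) fun u hu => ?_
    · exact (hb' (⟨hu, Metric.mem_closedBall_self hr.le⟩ :
        (u, (p.1.2 : ℂ)) ∈ Metric.closedBall (p.1.1 : ℂ) r ×ˢ _)).1
    · exact (hb' (⟨Metric.mem_closedBall_self hr.le, hu⟩ :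
        ((p.1.1 : ℂ), u) ∈ _ ×ˢ Metric.closedBall (p.1.2 : ℂ) r)).2
  · refine measure_mono_null (fun γ hγ => ?_)
      ((hm _ Metric.isClosed_sphere.measurableSet).symm.trans hs)
    rw [(isOpen_segmentedFlowBox _ _ _ _).frontier_eq] at hγ
    obtain ⟨q, hq, rfl⟩ := closure_segmentedFlowBox_subset _ _ _ _ hγ.1
    refine ⟨q, ⟨hb' hq, ?_⟩, rfl⟩
    rw [closedBall_prod_same] at hq
    refine le_antisymm hq (not_lt.1 fun hlt => hγ.2 ?_)
    rw [hbox]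
    exact ⟨q, hlt, rfl⟩
  · have h1 : m (Metric.closedBall (endpoints p) r) = m (Metric.ball (endpoints p) r) := by
      refine le_antisymm ?_ (measure_mono Metric.ball_subset_closedBall)
      rw [← Metric.ball_union_sphere]
      exact (measure_union_le _ _).trans (by rw [hs, add_zero])
    rw [h1, hm _ Metric.isOpen_ball.measurableSet, hbox,
      Set.inter_eq_self_of_subset_right (Metric.ball_subset_closedBall.trans hb)]

theorem isFiniteMeasure_of_endpoints {μ : Measure GeodesicSegments} {D₁ D₂ : Set ℂ}
    {m : Measure (ℂ × ℂ)} (hm : ∀ A, MeasurableSet A →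
      m A = μ (OrderedPair.toUnordered '' (endpoints ⁻¹' (D₁ ×ˢ D₂ ∩ A))))
    (h : μ (OrderedPair.toUnordered '' (endpoints ⁻¹' (D₁ ×ˢ D₂))) ≠ ⊤) :
    IsFiniteMeasure m :=
  ⟨by rw [hm _ MeasurableSet.univ, Set.inter_univ]; exact h.lt_top⟩

/-- Admissible flow boxes exist about every segment, because for all but countably many radii the
boundary of the box has measure `0`. -/
theorem exists_isAdmissible_mem (μ : Measure GeodesicSegments) [IsFiniteMeasureOnCompacts μ]
    (γ : GeodesicSegments) : ∃ B, IsAdmissible μ B ∧ γ ∈ B := by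
  induction γ using UnorderedPair.ind with | h p
  have hpos : 0 < dist (p.1.1 : ℂ) p.1.2 :=
    dist_pos.2 fun h => p.2 (UnitClosedDisc.coe_injective h)
  set d := dist (p.1.1 : ℂ) p.1.2 / 3 with hd
  have hd0 : 0 < d := by positivity
  have hB : IsSegmentedFlowBox (segmentedFlowBox p.1.1 p.1.2 d d) :=
    ⟨_, _, _, _, hd0, hd0, Metric.closedBall_disjoint_closedBall (by linarith), rfl⟩
  have hdisj : Disjoint (Metric.ball (p.1.1 : ℂ) d) (Metric.ball (p.1.2 : ℂ) d) :=
    Metric.ball_disjoint_ball (by linarith)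
  obtain ⟨m, hm⟩ := exists_measure_endpoints μ Metric.isOpen_ball Metric.isOpen_ball hdisj
  have : IsFiniteMeasure m := isFiniteMeasure_of_endpoints hm (by
    rw [← segmentedFlowBox_eq_image]
    exact hB.measure_ne_top μ)
  obtain ⟨r, hs, hr0, hrd⟩ := exists_sphere_null m (endpoints p) hd0
  obtain ⟨h1, h2, -⟩ := isAdmissible_of_sphere_null hdisj hm p hr0 (by
    rw [ball_prod_same]
    exact Metric.closedBall_subset_ball hrd) hs
  refine ⟨_, h1, ?_⟩
  rw [h2]
  exact ⟨p, Metric.mem_ball_self hr0, rfl⟩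

/-- Approximation of a flow box `B` from within, in measure, by finitely many disjoint admissible
flow boxes on which `f` oscillates by at most `δ`. This is the covering theorem of Besicovitch in
the product of two planes, whose balls are the products of two discs of equal radii. -/
theorem exists_finset_flowBox (μ : Measure GeodesicSegments) [IsFiniteMeasureOnCompacts μ]
    (f : C_c(GeodesicSegments, ℝ)) {B : Set GeodesicSegments} (hB : IsSegmentedFlowBox B)
    {δ : ℝ} (hδ : 0 < δ) :
    ∃ (T : Finset (ℂ × ℂ)) (b : ℂ × ℂ → Set GeodesicSegments) (c : ℂ × ℂ → ℝ),
      (∀ x ∈ T, IsAdmissible μ (b x) ∧ b x ⊆ B ∧ ∀ γ ∈ b x, |f γ - c x| ≤ δ) ∧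
      (T : Set (ℂ × ℂ)).PairwiseDisjoint b ∧ μ.real B - ∑ x ∈ T, μ.real (b x) < δ := by
  have hBtop := hB.measure_ne_top μ
  obtain ⟨x₁, x₂, ε₁, ε₂, hε₁, hε₂, hdc, rfl⟩ := hB
  set D := Metric.ball (x₁ : ℂ) ε₁ ×ˢ Metric.ball (x₂ : ℂ) ε₂ with hD
  have hDo : IsOpen D := Metric.isOpen_ball.prod Metric.isOpen_ball
  have hd : Disjoint (Metric.ball (x₁ : ℂ) ε₁) (Metric.ball (x₂ : ℂ) ε₂) :=
    hdc.mono Metric.ball_subset_closedBall Metric.ball_subset_closedBall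
  have hinj := injOn_toUnordered hd
  rw [segmentedFlowBox_eq_image] at hBtop ⊢
  obtain ⟨m, hm⟩ := exists_measure_endpoints μ Metric.isOpen_ball Metric.isOpen_ball hd
  have hfin : IsFiniteMeasure m := isFiniteMeasure_of_endpoints hm hBtop
  rw [← hD] at hm hBtop hinj ⊢
  have hloc : ∀ p : OrderedPair UnitClosedDisc, endpoints p ∈ D → ∃ R > 0,
      Metric.closedBall (endpoints p) R ⊆ D ∧
      ∀ q, endpoints q ∈ Metric.closedBall (endpoints p) R →
        |f q.toUnordered - f p.toUnordered| ≤ δ := by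
    intro p hp
    have hcont : Continuous fun q : OrderedPair UnitClosedDisc => f q.toUnordered :=
      f.continuous.comp (OrderedPair.isInvolutionQuotient_toUnordered _).isQuotientMap.continuous
    have h1 := (isEmbedding_endpoints.isInducing.nhds_eq_comap p).ge
      (hcont.continuousAt.eventually (Metric.closedBall_mem_nhds (f p.toUnordered) hδ))
    obtain ⟨R₁, hR₁, h2⟩ :=
      ((Metric.nhds_basis_closedBall (x := endpoints p)).comap endpoints).mem_iff.1 h1
    obtain ⟨R₂, hR₂, h3⟩ := Metric.nhds_basis_closedBall.mem_iff.1 (hDo.mem_nhds hp)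
    refine ⟨min R₁ R₂, lt_min hR₁ hR₂,
      (Metric.closedBall_subset_closedBall (min_le_right _ _)).trans h3, fun q hq => ?_⟩
    exact h2 (Metric.closedBall_subset_closedBall (min_le_left _ _) hq)
  choose! R hR0 hRD hRf using hloc
  -- the points of `D` that are endpoints of segments, each with a chosen segment
  have hsec : ∀ x ∈ endpoints '' (endpoints ⁻¹' D), ∃ p, endpoints p = x ∧ x ∈ D := by
    rintro _ ⟨p, hp, rfl⟩
    exact ⟨p, rfl, hp⟩
  have : Nonempty (OrderedPair UnitClosedDisc) := 
    ⟨⟨(0, 1), fun h => zero_ne_one (α := ℂ) (congrArg UnitClosedDisc.coe h)⟩⟩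
  choose! P hP hPD using hsec
  obtain ⟨t, r, htc, hts, htr, hnull, hdisj⟩ := Besicovitch.exists_disjoint_closedBall_covering_ae m
    (fun x => {r | m (Metric.sphere x r) = 0}) (endpoints '' (endpoints ⁻¹' D))
    (fun x _ δ' hδ' => exists_sphere_null m x hδ') (fun x => R (P x))
    (fun x hx => hR0 _ (by rw [hP x hx]; exact hPD x hx))
  let b : ℂ × ℂ → Set GeodesicSegments := fun x => segmentedFlowBox (P x).1.1 (P x).1.2 (r x) (r x)
  have hball : ∀ x ∈ t, Metric.closedBall x (r x) ⊆ Metric.closedBall x (R (P x)) := fun x hx =>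
    Metric.closedBall_subset_closedBall (htr x hx).2.2.le
  have hb : ∀ x ∈ t, IsAdmissible μ (b x) ∧
      b x = OrderedPair.toUnordered '' (endpoints ⁻¹' Metric.ball x (r x)) ∧
      μ (b x) = m (Metric.closedBall x (r x)) := by
    intro x hx
    have hPx := hP x (hts hx)
    have hxD := hPD x (hts hx)
    have h1 := isAdmissible_of_sphere_null hd hm (P x) (r := r x) (htr x hx).2.1
    rw [hPx] at h1
    refine h1 ((hball x hx).trans ?_) (htr x hx).1
    have h2 := hRD (P x) (by rwa [hPx])
    rwa [hPx] at h2
  have hballD : ∀ x ∈ t, Metric.ball x (r x) ⊆ D := by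
    intro x hx
    have h2 := hRD (P x) (by rw [hP x (hts hx)]; exact hPD x (hts hx))
    rw [hP x (hts hx)] at h2
    exact Metric.ball_subset_closedBall.trans ((hball x hx).trans h2)
  have hcompl : m (⋃ x ∈ t, Metric.closedBall x (r x))ᶜ = 0 := by
    have hU : MeasurableSet (⋃ x ∈ t, Metric.closedBall x (r x)) :=
      MeasurableSet.biUnion htc fun x _ => Metric.isClosed_closedBall.measurableSet
    obtain ⟨N, hN, hNm, hN0⟩ := exists_measurable_superset_of_null hnull
    rw [hm _ hU.compl]
    refine measure_mono_null (Set.image_mono ?_) ((hm N hNm).symm.trans hN0)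
    exact fun q hq => ⟨hq.1, hN ⟨⟨q, hq.1, rfl⟩, hq.2⟩⟩
  have hsum : HasSum (fun x : t => μ (b x)) (μ (OrderedPair.toUnordered '' (endpoints ⁻¹' D))) := by
    have h1 : m (⋃ x ∈ t, Metric.closedBall x (r x))
        = μ (OrderedPair.toUnordered '' (endpoints ⁻¹' D)) := by
      rw [← measure_congr (ae_eq_univ.2 hcompl).symm, hm _ MeasurableSet.univ, Set.inter_univ]
    rw [← h1, measure_biUnion htc hdisj fun x _ => Metric.isClosed_closedBall.measurableSet]
    simp only [fun x : t => (hb x x.2).2.2]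
    exact ENNReal.summable.hasSum
  have hreal : Tendsto (fun T : Finset t => ∑ x ∈ T, μ.real (b x)) atTop
      (𝓝 (μ.real (OrderedPair.toUnordered '' (endpoints ⁻¹' D)))) := by
    refine ((ENNReal.tendsto_toReal hBtop).comp hsum).congr fun T => ?_
    exact ENNReal.toReal_sum fun x _ => (hb x x.2).1.1.measure_ne_top μ
  obtain ⟨T, hT⟩ := (hreal.eventually_const_lt (sub_lt_self _ hδ)).exists
  refine ⟨T.map (Function.Embedding.subtype _), b, fun x => f (P x).toUnordered, ?_, ?_, ?_⟩
  · intro x hx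
    obtain ⟨⟨x, hxt⟩, -, rfl⟩ := Finset.mem_map.1 hx
    refine ⟨(hb x hxt).1, ?_, fun γ hγ => ?_⟩
    · change b x ⊆ _
      rw [(hb x hxt).2.1]
      exact Set.image_mono (Set.preimage_mono (hballD x hxt))
    · change γ ∈ b x at hγ
      rw [(hb x hxt).2.1] at hγ
      obtain ⟨q, hq, rfl⟩ := hγ
      refine hRf (P x) ?_ q ?_
      · rw [hP x (hts hxt)]
        exact hPD x (hts hxt)
      · rw [hP x (hts hxt)]
        exact hball x hxt (Metric.ball_subset_closedBall hq)
  · intro x hx y hy hxy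
    obtain ⟨⟨x, hxt⟩, -, rfl⟩ := Finset.mem_map.1 hx
    obtain ⟨⟨y, hyt⟩, -, rfl⟩ := Finset.mem_map.1 hy
    change Disjoint (b x) (b y)
    rw [(hb x hxt).2.1, (hb y hyt).2.1, Set.disjoint_left]
    rintro _ ⟨q, hq, rfl⟩ ⟨q', hq', he⟩
    have hqq := hinj (hballD y hyt hq') (hballD x hxt hq) he
    subst hqq
    exact Set.disjoint_left.1 (hdisj hxt hyt hxy) (Metric.ball_subset_closedBall hq)
      (Metric.ball_subset_closedBall hq')
  · rw [Finset.sum_map]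
    simp only [Function.Embedding.subtype_apply]
    linarith

section FlowBoxConvergence

variable {ι : Type*} {l : Filter ι} {ν : ι → Measure GeodesicSegments}
  {μ : Measure GeodesicSegments} [IsFiniteMeasureOnCompacts μ]
  [∀ i, IsFiniteMeasureOnCompacts (ν i)]

/-- On a flow box `B`, a test function differs from a step function on finitely many small boxes by
at most `δ` on these boxes and by at most its bound `M` on the small rest of `B`. -/
theorem integralTendsto_of_flowBox_of_support
    (H : ∀ B, IsAdmissible μ B → IntegralTendsto l ν μ (B.indicator fun _ => (1 : ℝ)))
    (f : C_c(GeodesicSegments, ℝ)) {B : Set GeodesicSegments} (hB : IsAdmissible μ B)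
    (hf : ∀ γ ∉ B, f γ = 0) : IntegralTendsto l ν μ f := by
  have hint : ∀ m : Measure GeodesicSegments, IsFiniteMeasureOnCompacts m → Integrable f m :=
    fun m _ => f.continuous.integrable_of_hasCompactSupport f.hasCompactSupport
  refine IntegralTendsto.of_sandwich (fun i => hint _ inferInstance) (hint _ inferInstance)
    fun ε hε => ?_
  obtain ⟨M, hM⟩ := f.hasCompactSupport.exists_bound_of_continuous f.continuous
  have hM0 : 0 ≤ M := by
    by_cases hne : Nonempty GeodesicSegments
    · exact (norm_nonneg _).trans (hM hne.some)
    · exact (hne ⟨UnorderedPair.mk 0 1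
        fun h => zero_ne_one (α := ℂ) (congrArg UnitClosedDisc.coe h)⟩).elim
  -- the error function below has `μ`-integral at most `δ * μ B + M * δ`
  set δ := ε / (2 * (μ.real B + M + 1)) with hδ
  have hden : 0 < 2 * (μ.real B + M + 1) := by positivity
  have hδ0 : 0 < δ := by positivity
  obtain ⟨T, b, c, hb, hdisj, hsum⟩ := exists_finset_flowBox μ f hB.1 hδ0
  have hH : ∀ x ∈ T, IntegralTendsto l ν μ ((b x).indicator fun _ => (1 : ℝ)) :=
    fun x hx => H _ (hb x hx).1
  have he := ((H B hB).const_mul δ).add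
    (((H B hB).sub (IntegralTendsto.sum T hH)).const_mul M)
  refine ⟨_, _, IntegralTendsto.sum T fun x hx => (hH x hx).const_mul (c x), he,
    fun γ => ?_, ?_⟩
  · by_cases hex : ∃ x ∈ T, γ ∈ b x
    · obtain ⟨x, hx, hγ⟩ := hex
      have hne : ∀ y ∈ T, y ≠ x → (b y).indicator (fun _ => (1 : ℝ)) γ = 0 := fun y hy hyx =>
        Set.indicator_of_notMem (Set.disjoint_left.1 (hdisj hx hy hyx.symm) hγ) _
      rw [Finset.sum_eq_single_of_mem x hx fun y hy hyx => by rw [hne y hy hyx, mul_zero],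
        Finset.sum_eq_single_of_mem x hx hne, Set.indicator_of_mem hγ,
        Set.indicator_of_mem ((hb x hx).2.1 hγ)]
      simpa using (hb x hx).2.2 γ hγ
    · push Not at hex
      rw [Finset.sum_eq_zero fun x hx => by rw [Set.indicator_of_notMem (hex x hx), mul_zero],
        Finset.sum_eq_zero fun x hx => Set.indicator_of_notMem (hex x hx) _]
      by_cases hγ : γ ∈ B
      · rw [Set.indicator_of_mem hγ]
        have := hM γ
        rw [Real.norm_eq_abs] at this
        simp only [sub_zero, mul_one]
        linarith
      · rw [hf γ hγ, Set.indicator_of_notMem hγ]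
        simp
  · have hHB := (H B hB).2.1
    have hHs := (IntegralTendsto.sum T hH).2.1
    have h1 : ∀ A : Set GeodesicSegments, MeasurableSet A →
        ∫ γ, A.indicator (fun _ => (1 : ℝ)) γ ∂μ = μ.real A := fun A hA =>
      integral_indicator_one hA
    have hHBs : Integrable (fun γ => B.indicator (fun _ => (1 : ℝ)) γ
        - ∑ x ∈ T, (b x).indicator (fun _ => (1 : ℝ)) γ) μ := hHB.sub hHs
    rw [integral_add (hHB.const_mul δ) (hHBs.const_mul M), integral_const_mul,
      integral_const_mul, integral_sub hHB hHs, integral_finsetSum _ fun x hx => (hH x hx).2.1,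
      h1 _ hB.1.isOpen.measurableSet,
      Finset.sum_congr rfl fun x hx => h1 _ (hb x hx).1.1.isOpen.measurableSet]
    have h2 : M * (μ.real B - ∑ x ∈ T, μ.real (b x)) ≤ M * δ :=
      mul_le_mul_of_nonneg_left hsum.le hM0
    have h3 : δ * (2 * (μ.real B + M + 1)) = ε := div_mul_cancel₀ _ hden.ne'
    nlinarith

theorem integralTendsto_of_flowBox
    (H : ∀ B, IsAdmissible μ B → IntegralTendsto l ν μ (B.indicator fun _ => (1 : ℝ)))
    (f : C_c(GeodesicSegments, ℝ)) : IntegralTendsto l ν μ f := by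
  choose B hB hmem using exists_isAdmissible_mem μ
  obtain ⟨t, ht⟩ := f.hasCompactSupport.isCompact.elim_finite_subcover B
    (fun γ => (hB γ).1.isOpen) fun γ _ => Set.mem_iUnion.2 ⟨γ, hmem γ⟩
  obtain ⟨ρ, hρ, hρ1, -, -⟩ := exists_continuous_sum_one_of_isOpen_isCompact
    (s := fun i : Fin t.card => B (t.equivFin.symm i)) (fun i => (hB _).1.isOpen)
    f.hasCompactSupport.isCompact (by
      intro γ hγ
      obtain ⟨x, hx, hγx⟩ := Set.mem_iUnion₂.1 (ht hγ)
      exact Set.mem_iUnion.2 ⟨t.equivFin ⟨x, hx⟩, by simpa using hγx⟩)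
  have hsum : ⇑f = fun γ => ∑ i, ρ i γ * f γ := by
    funext γ
    rw [← Finset.sum_mul]
    by_cases hγ : γ ∈ tsupport f
    · have := hρ1 hγ
      rw [Finset.sum_apply] at this
      rw [this, Pi.one_apply, one_mul]
    · rw [image_eq_zero_of_notMem_tsupport hγ, mul_zero]
  rw [hsum]
  refine IntegralTendsto.sum _ fun i _ => ?_
  refine integralTendsto_of_flowBox_of_support H
    ⟨⟨fun γ => ρ i γ * f γ, by fun_prop⟩, f.hasCompactSupport.mul_left⟩ (hB (t.equivFin.symm i))
    fun γ hγ => ?_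
  have h0 : ρ i γ = 0 := image_eq_zero_of_notMem_tsupport fun h => hγ (hρ i h)
  change ρ i γ * f γ = 0
  rw [h0, zero_mul]

end FlowBoxConvergence

/-- The filters that define the flow box topology are the neighbourhood filters of the weak-*
topology. -/
theorem flowBox_filter_eq_nhds (Γ : Subgroup SU11)
    (μ : InvariantRadonMeasure Γ GeodesicSegments actSegments) :
    (⨅ (𝓑 : Set (Set GeodesicSegments)) (_ : 𝓑.Finite ∧ ∀ B ∈ 𝓑, IsAdmissible μ.1 B)
        (ε : ℝ) (_ : 0 < ε),
        𝓟 {ν : InvariantRadonMeasure Γ GeodesicSegments actSegments |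
          ∀ B ∈ 𝓑, |μ.1.real B - ν.1.real B| < ε})
      = @nhds _ (weakStarTopology Γ GeodesicSegments actSegments) μ := by
  let := weakStarTopology Γ GeodesicSegments actSegments
  have hreg : ∀ ν : InvariantRadonMeasure Γ GeodesicSegments actSegments, ν.1.Regular :=
    fun ν => ν.2.1
  have := hreg μ
  have hind : ∀ (B : Set GeodesicSegments), IsSegmentedFlowBox B →
      ∀ ν : InvariantRadonMeasure Γ GeodesicSegments actSegments,
      ∫ γ, B.indicator (fun _ => (1 : ℝ)) γ ∂ν.1 = ν.1.real B := fun B hB ν =>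
    integral_indicator_one hB.isOpen.measurableSet
  apply le_antisymm
  · refine (map_le_iff_le_comap.1 ?_).trans (nhds_induced _ _).ge
    refine tendsto_pi_nhds.2 fun f => ?_
    refine (integralTendsto_of_flowBox
      (ν := fun ν : InvariantRadonMeasure Γ GeodesicSegments actSegments => ν.1)
      (fun B hB => ⟨fun ν => ?_, ?_, ?_⟩) f).2.2
    · exact integrable_indicator_one hB.1.isOpen.measurableSet (hB.1.measure_ne_top _)
    · exact integrable_indicator_one hB.1.isOpen.measurableSet (hB.1.measure_ne_top _)
    · simp only [hind B hB.1]
      refine Metric.tendsto_nhds.2 fun ε hε => ?_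
      refine mem_iInf_of_mem {B} (mem_iInf_of_mem ⟨Set.finite_singleton B, by simpa using hB⟩
        (mem_iInf_of_mem ε (mem_iInf_of_mem hε (mem_principal.2 fun ν hν => ?_))))
      have := hν B rfl
      rwa [Set.mem_ofPred_eq, dist_comm, Real.dist_eq]
  · refine le_iInf fun 𝓑 => le_iInf fun h𝓑 => le_iInf fun ε => le_iInf fun hε => ?_
    rw [le_principal_iff]
    refine (Filter.eventually_all_finite h𝓑.1).2 fun B hB => ?_
    have hadm := h𝓑.2 B hB
    have htend := (integralTendsto_indicator (l := 𝓝 μ)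
      (ν := fun ν : InvariantRadonMeasure Γ GeodesicSegments actSegments => ν.1) hreg (hreg μ)
      (fun f => ⟨fun ν => f.continuous.integrable_of_hasCompactSupport f.hasCompactSupport,
        f.continuous.integrable_of_hasCompactSupport f.hasCompactSupport,
        (continuous_integral_weakStar Γ actSegments f).tendsto μ⟩)
      hadm.1.isOpen hadm.1.isCompact_closure hadm.2).2.2
    simp only [hind B hadm.1] at htend
    filter_upwards [Metric.tendsto_nhds.1 htend ε hε] with ν hν
    rwa [dist_comm, Real.dist_eq] at hν

theorem currentWithCorners_topology_eq_weakStar (S : ClosedHyperbolicSurface) :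
    (inferInstance : TopologicalSpace (CurrentWithCorners S))
      = weakStarTopology S.deck GeodesicSegments actSegments := by
  refine TopologicalSpace.ext_iff.2 fun s => Iff.trans ?_
    (@isOpen_iff_mem_nhds _ (weakStarTopology S.deck GeodesicSegments actSegments) s).symm
  exact forall₂_congr fun μ _ =>
    iff_of_eq (congrArg (fun F : Filter _ => s ∈ F) (flowBox_filter_eq_nhds S.deck μ))

/-! ### Geodesics as geodesic segments -/

theorem continuous_circleToClosedDisc : Continuous circleToClosedDisc := by
  rw [UnitClosedDisc.isEmbedding_coe.continuous_iff]
  exact continuous_circle_coe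

theorem isClosedEmbedding_circleToClosedDisc : IsClosedEmbedding circleToClosedDisc :=
  continuous_circleToClosedDisc.isClosedEmbedding circleToClosedDisc_injective

/-- An ordered pair of points at infinity as an oriented segment. -/
def orderedGeodesicToSegment (p : OrderedPair Circle) : OrderedPair UnitClosedDisc :=
  ⟨(circleToClosedDisc p.1.1, circleToClosedDisc p.1.2),
    fun h => p.2 (circleToClosedDisc_injective h)⟩

theorem isClosedEmbedding_orderedGeodesicToSegment :
    IsClosedEmbedding orderedGeodesicToSegment := by
  have hj := isClosedEmbedding_circleToClosedDisc.prodMap isClosedEmbedding_circleToClosedDisc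
  have hcont : Continuous orderedGeodesicToSegment :=
    (hj.continuous.comp continuous_subtype_val).subtype_mk _
  refine ⟨IsEmbedding.of_comp hcont continuous_subtype_val
    (hj.isEmbedding.comp IsEmbedding.subtypeVal), ?_⟩
  convert hj.isClosed_range.preimage
    (continuous_subtype_val (p := fun p : UnitClosedDisc × UnitClosedDisc => p.1 ≠ p.2)) using 1
  ext p
  constructor
  · rintro ⟨q, rfl⟩
    exact ⟨q.1, rfl⟩
  · rintro ⟨q, hq⟩
    refine ⟨⟨q, fun h => p.2 ?_⟩, Subtype.ext hq⟩
    rw [← hq]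
    exact congrArg circleToClosedDisc h

theorem isClosedEmbedding_geodesicToSegment : IsClosedEmbedding geodesicToSegment := by
  have hG := OrderedPair.isInvolutionQuotient_toUnordered Circle
  have hS := OrderedPair.isInvolutionQuotient_toUnordered UnitClosedDisc
  have hcomp : ∀ p : OrderedPair Circle,
      geodesicToSegment p.toUnordered = (orderedGeodesicToSegment p).toUnordered := fun _ => rfl
  refine IsClosedEmbedding.of_continuous_injective_isClosedMap
    (UnorderedPair.continuous_map _ continuous_circleToClosedDisc) ?_ fun C hC => ?_
  · intro γ γ' h
    induction γ using UnorderedPair.ind with | h p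
    induction γ' using UnorderedPair.ind with | h q
    have hinj := circleToClosedDisc_injective
    refine UnorderedPair.mk_eq_mk_iff.2 ((UnorderedPair.mk_eq_mk_iff.1 h).imp ?_ ?_)
    · exact fun e => ⟨hinj e.1, hinj e.2⟩
    · exact fun e => ⟨hinj e.1, hinj e.2⟩
  · have h1 : geodesicToSegment '' C = OrderedPair.toUnordered ''
        (orderedGeodesicToSegment '' (OrderedPair.toUnordered ⁻¹' C)) := by
      conv_lhs => rw [← Set.image_preimage_eq C hG.isQuotientMap.surjective]
      simp only [Set.image_image, hcomp]
    rw [h1]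
    exact hS.isClosedMap _ (isClosedEmbedding_orderedGeodesicToSegment.isClosedMap _
      (hC.preimage hG.isQuotientMap.continuous))

/-- Restriction of test functions from geodesic segments to bi-infinite geodesics. -/
def restrictToGeodesics : C_c(GeodesicSegments, ℝ) →ₗ[ℝ] C_c(Geodesics, ℝ) where
  toFun φ := ⟨⟨fun γ => φ (geodesicToSegment γ),
      φ.continuous.comp isClosedEmbedding_geodesicToSegment.continuous⟩,
    φ.hasCompactSupport.comp_isClosedEmbedding isClosedEmbedding_geodesicToSegment⟩
  map_add' _ _ := rfl
  map_smul' _ _ := rfl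

/-- The push-forward of geodesic currents to currents with corners is dual to the restriction of
test functions, which is surjective by Tietze's theorem. -/
theorem exists_isClosedEmbedding_toSegments (S : ClosedHyperbolicSurface) :
    ∃ F : GeodesicCurrent S → CurrentWithCorners S,
      (∀ μ, (F μ).1 = toSegments μ.1) ∧ IsClosedEmbedding F := by
  have hemb := isClosedEmbedding_geodesicToSegment
  have hmeas := hemb.measurableEmbedding
  have h := exists_isClosedEmbedding_of_dual (Γ := S.deck) (actX := actGeodesics)
    (actY := actSegments) toSegments restrictToGeodesics ?_ ?_ ?_ ?_ ?_
  · obtain ⟨F, hF, hF'⟩ := h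
    refine ⟨F, hF, ?_⟩
    have ht := currentWithCorners_topology_eq_weakStar S
    rw [← ht] at hF'
    exact hF'
  · intro μ hμ
    refine regular_of_isCompact_lt_top fun K hK => ?_
    rw [toSegments, hmeas.map_apply]
    exact (hemb.isCompact_preimage hK).measure_lt_top
  · intro μ hμ φ
    exact hmeas.integral_map _
  · exact fun g _ => regular_map_actGeodesics g
  · intro g _ μ _
    rw [toSegments, toSegments, Measure.map_map hmeas.measurable
      (continuous_actGeodesics g).measurable, Measure.map_map
      (continuous_actSegments g).measurable hmeas.measurable]
    congr 1
    funext γ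
    induction γ using UnorderedPair.ind with | h p
    rfl
  · intro f
    obtain ⟨φ, hφ, hpos⟩ := exists_comp_eq_of_isProperMap hemb.isProperMap f
      fun a b hab => congrArg f (hemb.injective hab)
    exact ⟨φ, CompactlySupportedContinuousMap.ext hφ, hpos⟩

/-! ### Hopf coordinates on the unit tangent bundle

A unit tangent vector of the disc at `x` with direction `u` determines the geodesic with endpoints
`(x ± u) / (1 ± conj x u)`, and the ratio `|1 + conj x u| / |1 - conj x u|` is the exponential of the
arclength parameter of `x` on it. -/

/-- The endpoint at infinity of the geodesic ray from `x` in the direction `u`. -/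
def rayEnd (x u : ℂ) : ℂ := (x + u) / (1 + conj x * u)

theorem ray_den_ne_zero {x u : ℂ} (hx : ‖x‖ < 1) (hu : ‖u‖ = 1) : 1 + conj x * u ≠ 0 := by
  have h := den_ne_zero (a := 1) (b := x) (z := u) (by simpa using hx) hu.le
  rwa [map_one, add_comm] at h

theorem conj_mul_self_of_norm_eq_one {u : ℂ} (hu : ‖u‖ = 1) : conj u * u = 1 := by
  rw [mul_comm, Complex.mul_conj, Complex.normSq_eq_norm_sq, hu]
  norm_num

theorem norm_rayEnd {x u : ℂ} (hx : ‖x‖ < 1) (hu : ‖u‖ = 1) : ‖rayEnd x u‖ = 1 := by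
  have h := norm_mobius_eq_one (a := 1) (b := x) (z := u) (by simpa using hx) hu
  rw [map_one, one_mul] at h
  rwa [rayEnd, add_comm x, add_comm 1]

theorem rayEnd_mul_den {x u : ℂ} (hx : ‖x‖ < 1) (hu : ‖u‖ = 1) :
    rayEnd x u * (1 + conj x * u) = x + u :=
  div_mul_cancel₀ _ (ray_den_ne_zero hx hu)

/-- The numerator of the endpoint of the image of a ray under a Moebius transformation. -/
theorem mobius_add_deriv {a b x u D : ℂ} (hD : D = conj b * x + conj a) :
    (a * x + b) / D + conj D / D * u = (a * (x + u) + b * (1 + conj x * u)) / D := by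
  rw [div_mul_eq_mul_div, ← add_div, hD]
  simp only [map_add, map_mul, Complex.conj_conj]
  ring

/-- The denominator of the endpoint of the image of a ray under a Moebius transformation. -/
theorem one_add_conj_mobius_mul_deriv {a b x u D : ℂ} (hD : D = conj b * x + conj a)
    (hD0 : D ≠ 0) :
    1 + conj ((a * x + b) / D) * (conj D / D * u)
      = (conj b * (x + u) + conj a * (1 + conj x * u)) / D := by
  have hD' : conj D ≠ 0 := (map_ne_zero (starRingEnd ℂ)).2 hD0
  have h1 : conj ((a * x + b) / D) * (conj D / D * u) = conj (a * x + b) * u / D := by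
    rw [map_div₀]
    field_simp
  rw [h1, eq_div_iff hD0, add_mul, div_mul_cancel₀ _ hD0, hD]
  simp only [map_add, map_mul]
  ring

/-- The rays of the disc are mapped to each other by a Moebius transformation together with its
derivative, whose direction is `conj D / D` for the denominator `D`. -/
theorem rayEnd_mobius {a b x u : ℂ} (hab : ‖b‖ < ‖a‖) (hx : ‖x‖ < 1) (hu : ‖u‖ = 1) :
    rayEnd ((a * x + b) / (conj b * x + conj a))
        (conj (conj b * x + conj a) / (conj b * x + conj a) * u)
      = (a * rayEnd x u + b) / (conj b * rayEnd x u + conj a) := by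
  have hD := den_ne_zero hab hx.le
  have hd := ray_den_ne_zero hx hu
  have hr := rayEnd_mul_den hx hu
  have h1 : a * (x + u) + b * (1 + conj x * u) = (a * rayEnd x u + b) * (1 + conj x * u) := by
    linear_combination -a * hr
  have h2 : conj b * (x + u) + conj a * (1 + conj x * u)
      = (conj b * rayEnd x u + conj a) * (1 + conj x * u) := by
    linear_combination -conj b * hr
  rw [rayEnd, mobius_add_deriv rfl, one_add_conj_mobius_mul_deriv rfl hD,
    div_div_div_cancel_right₀ hD, h1, h2, mul_div_mul_right _ _ hd]

theorem norm_one_add_conj_mobius {a b x u : ℂ} (hab : ‖b‖ < ‖a‖) (hx : ‖x‖ < 1) (hu : ‖u‖ = 1) :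
    ‖1 + conj ((a * x + b) / (conj b * x + conj a))
        * (conj (conj b * x + conj a) / (conj b * x + conj a) * u)‖
      = ‖conj b * rayEnd x u + conj a‖ * ‖1 + conj x * u‖ / ‖conj b * x + conj a‖ := by
  rw [one_add_conj_mobius_mul_deriv rfl (den_ne_zero hab hx.le), norm_div, ← norm_mul]
  congr 2
  linear_combination -conj b * rayEnd_mul_den hx hu

/-- The exponential of the arclength parameter of `x` on its geodesic. -/
def rayRatio (x u : ℂ) : ℝ := ‖1 + conj x * u‖ / ‖1 + conj x * -u‖

theorem rayRatio_pos {x u : ℂ} (hx : ‖x‖ < 1) (hu : ‖u‖ = 1) : 0 < rayRatio x u :=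
  div_pos (norm_pos_iff.2 (ray_den_ne_zero hx hu))
    (norm_pos_iff.2 (ray_den_ne_zero hx (by rwa [norm_neg])))

/-- A Moebius transformation translates the arclength parameter by an amount that depends only on
the geodesic. -/
theorem rayRatio_mobius {a b x u : ℂ} (hab : ‖b‖ < ‖a‖) (hx : ‖x‖ < 1) (hu : ‖u‖ = 1) :
    rayRatio ((a * x + b) / (conj b * x + conj a))
        (conj (conj b * x + conj a) / (conj b * x + conj a) * u)
      = ‖conj b * rayEnd x u + conj a‖ / ‖conj b * rayEnd x (-u) + conj a‖ * rayRatio x u := by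
  have hu' : ‖-u‖ = 1 := by rwa [norm_neg]
  have hD := norm_ne_zero_iff.2 (den_ne_zero hab hx.le)
  rw [rayRatio, rayRatio, ← mul_neg, norm_one_add_conj_mobius hab hx hu,
    norm_one_add_conj_mobius hab hx hu', div_div_div_cancel_right₀ hD, mul_div_mul_comm]

/-- A unit tangent vector is determined by the endpoints of its geodesic and by the arclength
parameter. -/
theorem eq_of_rayEnd_eq {x u x' u' : ℂ} (hx : ‖x‖ < 1) (hu : ‖u‖ = 1) (hx' : ‖x'‖ < 1)
    (hu' : ‖u'‖ = 1) (h₁ : rayEnd x u = rayEnd x' u') (h₂ : rayEnd x (-u) = rayEnd x' (-u'))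
    (h₃ : rayRatio x u = rayRatio x' u') : x = x' ∧ u = u' := by
  have huu := conj_mul_self_of_norm_eq_one hu
  have huu' := conj_mul_self_of_norm_eq_one hu'
  have hq := ray_den_ne_zero hx hu
  have hq' := ray_den_ne_zero hx' hu'
  have hp := ray_den_ne_zero hx (u := -u) (by rwa [norm_neg])
  have hp' := ray_den_ne_zero hx' (u := -u') (by rwa [norm_neg])
  rw [rayRatio, rayRatio, div_eq_div_iff (norm_ne_zero_iff.2 hp) (norm_ne_zero_iff.2 hp'),
    ← norm_mul, ← norm_mul] at h₃
  rw [rayEnd, rayEnd, div_eq_div_iff hq hq'] at h₁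
  rw [rayEnd, rayEnd, div_eq_div_iff hp hp'] at h₂
  rw [mul_neg] at hp hp' h₂ h₃
  rw [mul_neg] at h₂ h₃
  set α := conj x * u with hα
  set α' := conj x' * u' with hα'
  have hxα : x = u * conj α := by
    rw [hα, map_mul, Complex.conj_conj]
    linear_combination -x * huu
  have hxα' : x' = u' * conj α' := by
    rw [hα', map_mul, Complex.conj_conj]
    linear_combination -x' * huu'
  have hu0 : u ≠ 0 := norm_ne_zero_iff.1 (by rw [hu]; exact one_ne_zero)
  have e₁ : u * (1 + conj α) * (1 + α') = u' * (1 + conj α') * (1 + α) := by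
    linear_combination h₁ - (1 + α') * hxα + (1 + α) * hxα'
  have e₂ : u * (1 - conj α) * (1 - α') = u' * (1 - conj α') * (1 - α) := by
    linear_combination -h₂ + (1 - α') * hxα - (1 - α) * hxα'
  -- the two products below have the same modulus, and up to a sign the same argument
  set N := (1 + α) * (1 - α') with hN
  set N' := (1 + α') * (1 - α) with hN'
  have hcN : conj N = (1 + conj α) * (1 - conj α') := by simp [hN]
  have hcN' : conj N' = (1 + conj α') * (1 - conj α) := by simp [hN']
  have hu0' : u' ≠ 0 := norm_ne_zero_iff.1 (by rw [hu']; exact one_ne_zero)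
  have e₃ : conj N * N' = conj N' * N := by
    refine mul_left_cancel₀ (mul_ne_zero hu0 hu0') ?_
    rw [hcN, hcN', hN, hN']
    linear_combination u' * (1 - conj α') * (1 - α) * e₁ - u' * (1 + conj α') * (1 + α) * e₂
  have hN0 : N ≠ 0 := mul_ne_zero hq (by rwa [sub_eq_add_neg])
  have hnorm : ‖N‖ = ‖N'‖ := by simpa only [← sub_eq_add_neg] using h₃
  have e₄ : conj N * N = conj N' * N' := by
    rw [mul_comm, mul_comm (conj N'), Complex.mul_conj, Complex.mul_conj,
      Complex.normSq_eq_norm_sq, Complex.normSq_eq_norm_sq, hnorm]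
  have e₅ : N ^ 2 = N' ^ 2 := by
    refine mul_left_cancel₀ ((map_ne_zero (starRingEnd ℂ)).2 hN0) ?_
    linear_combination N * e₄ - N' * e₃
  have hαα' : α = α' := by
    rcases sq_eq_sq_iff_eq_or_eq_neg.1 e₅ with h | h
    · linear_combination h / 2
    · have h1 : α * α' = 1 := by linear_combination -h / 2
      have h2 : ‖α * α'‖ < 1 := by
        rw [hα, hα', norm_mul, norm_mul, norm_mul, RCLike.norm_conj, RCLike.norm_conj, hu, hu']
        nlinarith [norm_nonneg x, norm_nonneg x']
      rw [h1, norm_one] at h2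
      exact (lt_irrefl _ h2).elim
  have huu'' : u = u' := by
    rw [← hαα'] at e₁
    have hcq : 1 + conj α ≠ 0 := by
      have := (map_ne_zero (starRingEnd ℂ)).2 hq
      simpa using this
    exact mul_right_cancel₀ hcq (mul_right_cancel₀ hq e₁)
  exact ⟨by rw [hxα, hxα', hαα', huu''], huu''⟩

/-! ### The parametrized geodesic in Hopf coordinates -/

theorem centerPoint_swap (ξ η : Circle) : centerPoint η ξ = centerPoint ξ η := by
  unfold centerPoint
  rw [norm_sub_rev, add_comm (η : ℂ)]

theorem centerDirection_swap (ξ η : Circle) : centerDirection η ξ = -centerDirection ξ η := by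
  unfold centerDirection
  rw [norm_sub_rev, ← neg_div, neg_sub]

theorem conj_circle_mul_self (ξ : Circle) : conj (ξ : ℂ) * ξ = 1 :=
  conj_mul_self_of_norm_eq_one ξ.norm_coe

theorem conj_centerPoint_mul_centerDirection (ξ η : Circle) :
    conj (centerPoint ξ η) * centerDirection ξ η
      = (conj (ξ : ℂ) * η - conj (η : ℂ) * ξ)
        / ((2 + ‖(ξ : ℂ) - η‖ : ℝ) * (‖(ξ : ℂ) - η‖ : ℝ)) := by
  rw [centerPoint, centerDirection, map_div₀, Complex.conj_ofReal, div_mul_div_comm, map_add]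
  congr 1
  linear_combination conj_circle_mul_self η - conj_circle_mul_self ξ

theorem mobius_centerDirection {ξ η : Circle} (h : ξ ≠ η) :
    (1 * centerDirection ξ η + centerPoint ξ η)
      / (conj (centerPoint ξ η) * centerDirection ξ η + conj 1) = η := by
  have h0 : 0 < ‖(ξ : ℂ) - η‖ := norm_pos_iff.2 (sub_ne_zero.2 (fun e => h (Circle.ext e)))
  have hd := den_ne_zero (a := 1) (b := centerPoint ξ η)
    (by rw [norm_one]; exact norm_centerPoint_lt_one h) (norm_centerDirection h).le
  rw [div_eq_iff hd, conj_centerPoint_mul_centerDirection, map_one, centerPoint, centerDirection]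
  have hsq : ((‖(ξ : ℂ) - η‖ : ℝ) : ℂ) ^ 2 = (ξ - η) * (conj (ξ : ℂ) - conj (η : ℂ)) := by
    rw [← map_sub, Complex.mul_conj, Complex.normSq_eq_norm_sq]
    norm_cast
  have hd0 : ((‖(ξ : ℂ) - η‖ : ℝ) : ℂ) ≠ 0 := by exact_mod_cast h0.ne'
  have hd2 : ((2 + ‖(ξ : ℂ) - η‖ : ℝ) : ℂ) ≠ 0 := by
    exact_mod_cast (by positivity : (2 + ‖(ξ : ℂ) - η‖ : ℝ) ≠ 0)
  push_cast at hd2 ⊢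
  set d : ℂ := ((‖(ξ : ℂ) - η‖ : ℝ) : ℂ)
  field_simp
  have h1 := conj_circle_mul_self ξ
  have h2 := conj_circle_mul_self η
  linear_combination (-(η : ℂ)) * hsq + (2 * ξ - η) * h2 - (η : ℂ) * h1

theorem norm_conj_centerPoint_swap (ξ η : Circle) :
    ‖conj (centerPoint ξ η) * -centerDirection ξ η + conj 1‖
      = ‖conj (centerPoint ξ η) * centerDirection ξ η + conj 1‖ := by
  rw [← RCLike.norm_conj]
  congr 1
  rw [mul_neg, conj_centerPoint_mul_centerDirection]
  simp only [map_add, map_neg, map_div₀, map_sub, map_mul, Complex.conj_ofReal, Complex.conj_conj,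
    map_one]
  ring

theorem one_add_tanh_div_one_sub_tanh (t : ℝ) :
    (1 + Real.tanh (t / 2)) / (1 - Real.tanh (t / 2)) = Real.exp t := by
  have hc := (Real.cosh_pos (t / 2)).ne'
  have h1 : 1 + Real.tanh (t / 2) = Real.exp (t / 2) / Real.cosh (t / 2) := by
    rw [Real.tanh_eq_sinh_div_cosh, ← Real.cosh_add_sinh]
    field_simp
  have h2 : 1 - Real.tanh (t / 2) = Real.exp (-(t / 2)) / Real.cosh (t / 2) := by
    rw [Real.tanh_eq_sinh_div_cosh, ← Real.cosh_sub_sinh]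
    field_simp
  rw [h1, h2, div_div_div_cancel_right₀ hc, ← Real.exp_sub]
  congr 1
  ring

/-- The unit direction of a geodesic at time `t`, as a point of the circle; `geodesicDirection` is
the same point, seen in the closed disc. -/
def unitDirection (ξ η : Circle) (h : ξ ≠ η) (t : ℝ) : Circle :=
  unitInvSq (geodesicDen ξ η t) (geodesicDen_ne_zero h t) *
    ⟨centerDirection ξ η, mem_sphere_zero_iff_norm.2 (norm_centerDirection h)⟩

/-- Hopf coordinates along the diameter in the direction `u`. -/
theorem rayEnd_radial {u : ℂ} (hu : ‖u‖ = 1) {s : ℝ} (hs : |s| < 1) :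
    rayEnd (u * s) u = u ∧ rayEnd (u * s) (-u) = -u ∧ rayRatio (u * s) u = (1 + s) / (1 - s) := by
  have huu := conj_mul_self_of_norm_eq_one hu
  obtain ⟨hs1, hs2⟩ := abs_lt.1 hs
  have h1 : 1 + conj (u * s) * u = ((1 + s : ℝ) : ℂ) := by
    rw [map_mul, Complex.conj_ofReal]
    push_cast
    linear_combination (s : ℂ) * huu
  have h2 : 1 + conj (u * s) * -u = ((1 - s : ℝ) : ℂ) := by
    rw [map_mul, Complex.conj_ofReal]
    push_cast
    linear_combination (-(s : ℂ)) * huu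
  have h3 : ((1 + s : ℝ) : ℂ) ≠ 0 := by exact_mod_cast (by linarith : (1 + s : ℝ) ≠ 0)
  have h4 : ((1 - s : ℝ) : ℂ) ≠ 0 := by exact_mod_cast (by linarith : (1 - s : ℝ) ≠ 0)
  refine ⟨?_, ?_, ?_⟩
  · rw [rayEnd, h1, div_eq_iff h3]
    push_cast
    ring
  · rw [rayEnd, h2, div_eq_iff h4]
    push_cast
    ring
  · rw [rayRatio, h1, h2, Complex.norm_real, Complex.norm_real, Real.norm_of_nonneg (by linarith),
      Real.norm_of_nonneg (by linarith)]

/-- The Hopf coordinates of the point at time `t` of the geodesic from `ξ` to `η`. -/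
theorem rayEnd_geodesicPoint {ξ η : Circle} (h : ξ ≠ η) (t : ℝ) :
    rayEnd (geodesicPoint ξ η h t) (unitDirection ξ η h t) = η ∧
      rayEnd (geodesicPoint ξ η h t) (-(unitDirection ξ η h t : ℂ)) = ξ ∧
      rayRatio (geodesicPoint ξ η h t) (unitDirection ξ η h t) = Real.exp t := by
  have hu := norm_centerDirection h
  have hu' : ‖-centerDirection ξ η‖ = 1 := by rwa [norm_neg]
  have hc : ‖centerPoint ξ η‖ < ‖(1 : ℂ)‖ := by rw [norm_one]; exact norm_centerPoint_lt_one h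
  have hx := norm_centerDirection_mul_lt h t
  obtain ⟨h1, h2, h3⟩ := rayEnd_radial hu (Real.abs_tanh_lt_one (t / 2))
  have hU : (unitDirection ξ η h t : ℂ)
      = conj (geodesicDen ξ η t) / geodesicDen ξ η t * centerDirection ξ η := rfl
  have hX : (geodesicPoint ξ η h t : ℂ)
      = (1 * (centerDirection ξ η * (Real.tanh (t / 2) : ℝ)) + centerPoint ξ η)
        / geodesicDen ξ η t := rfl
  have hs := mobius_centerDirection h.symm
  rw [centerPoint_swap, centerDirection_swap] at hs
  rw [hU, hX, ← mul_neg]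
  refine ⟨?_, ?_, ?_⟩
  · exact (rayEnd_mobius hc hx hu).trans (by rw [h1]; exact mobius_centerDirection h)
  · exact (rayEnd_mobius hc hx hu').trans (by rw [h2]; exact hs)
  · refine (rayRatio_mobius hc hx hu).trans ?_
    rw [h1, h2, norm_conj_centerPoint_swap, div_self, one_mul, h3, one_add_tanh_div_one_sub_tanh]
    exact norm_ne_zero_iff.2 (den_ne_zero hc hu.le)

/-! ### The homeomorphism given by Hopf coordinates -/

theorem rayEnd_ne_rayEnd_neg {x u : ℂ} (hx : ‖x‖ < 1) (hu : ‖u‖ = 1) :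
    rayEnd x (-u) ≠ rayEnd x u := by
  intro h
  have hu' : ‖-u‖ = 1 := by rwa [norm_neg]
  rw [rayEnd, rayEnd, div_eq_div_iff (ray_den_ne_zero hx hu') (ray_den_ne_zero hx hu)] at h
  have h1 : u = u * (conj x * x) := by
    linear_combination (-1 / 2 : ℂ) * h
  have h2 : ‖u‖ = ‖u * (conj x * x)‖ := congrArg _ h1
  rw [norm_mul, norm_mul, RCLike.norm_conj, hu] at h2
  nlinarith [norm_nonneg x]

/-- The point of the unit tangent bundle at time `t` of the oriented geodesic `p`. -/
def hopfPoint (q : OrderedPair Circle × ℝ) : UnitDisc × Circle :=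
  (geodesicPoint q.1.1.1 q.1.1.2 q.1.2 q.2, unitDirection q.1.1.1 q.1.1.2 q.1.2 q.2)

/-- The Hopf coordinates of a unit tangent vector: the endpoints of its oriented geodesic and the
arclength parameter. -/
def hopfCoord (v : UnitDisc × Circle) : OrderedPair Circle × ℝ :=
  (⟨(⟨rayEnd v.1 (-(v.2 : ℂ)), mem_sphere_zero_iff_norm.2
        (norm_rayEnd v.1.norm_lt_one (by rw [norm_neg, v.2.norm_coe]))⟩,
      ⟨rayEnd v.1 v.2, mem_sphere_zero_iff_norm.2 (norm_rayEnd v.1.norm_lt_one v.2.norm_coe)⟩),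
    fun h => rayEnd_ne_rayEnd_neg v.1.norm_lt_one v.2.norm_coe
      (congrArg (fun z : Circle => (z : ℂ)) h)⟩,
    Real.log (rayRatio v.1 v.2))

theorem hopfCoord_injective : Function.Injective hopfCoord := by
  intro v w h
  have h1 := congrArg (fun q : OrderedPair Circle × ℝ => (q.1.1.1 : ℂ)) h
  have h2 := congrArg (fun q : OrderedPair Circle × ℝ => (q.1.1.2 : ℂ)) h
  have h3 := congrArg (fun q : OrderedPair Circle × ℝ => q.2) h
  have h4 := Real.log_injOn_pos (rayRatio_pos v.1.norm_lt_one v.2.norm_coe)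
    (rayRatio_pos w.1.norm_lt_one w.2.norm_coe) h3
  obtain ⟨hx, hu⟩ := eq_of_rayEnd_eq v.1.norm_lt_one v.2.norm_coe w.1.norm_lt_one w.2.norm_coe
    h2 h1 h4
  exact Prod.ext (UnitDisc.coe_injective hx) (Circle.ext hu)

theorem hopfCoord_hopfPoint (q : OrderedPair Circle × ℝ) : hopfCoord (hopfPoint q) = q := by
  obtain ⟨⟨⟨ξ, η⟩, h⟩, t⟩ := q
  obtain ⟨h1, h2, h3⟩ := rayEnd_geodesicPoint h t
  refine Prod.ext (Subtype.ext (Prod.ext (Circle.ext h2) (Circle.ext h1))) ?_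
  exact (congrArg Real.log h3).trans (Real.log_exp t)

theorem continuous_real_tanh : Continuous Real.tanh := by
  have : Real.tanh = fun x => Real.sinh x / Real.cosh x := funext Real.tanh_eq_sinh_div_cosh
  rw [this]
  exact Real.continuous_sinh.div Real.continuous_cosh fun x => (Real.cosh_pos x).ne'

theorem continuous_hopfPoint : Continuous hopfPoint := by
  have hξ : Continuous fun q : OrderedPair Circle × ℝ => (q.1.1.1 : ℂ) := by
    have := continuous_circle_coe
    fun_prop
  have hη : Continuous fun q : OrderedPair Circle × ℝ => (q.1.1.2 : ℂ) := by
    have := continuous_circle_coe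
    fun_prop
  have hnorm : Continuous fun q : OrderedPair Circle × ℝ => ‖(q.1.1.1 : ℂ) - q.1.1.2‖ :=
    (hξ.sub hη).norm
  have hpos : ∀ q : OrderedPair Circle × ℝ, ‖(q.1.1.1 : ℂ) - q.1.1.2‖ ≠ 0 := fun q =>
    norm_ne_zero_iff.2 (sub_ne_zero.2 fun e => q.1.2 (Circle.ext e))
  have hc : Continuous fun q : OrderedPair Circle × ℝ => centerPoint q.1.1.1 q.1.1.2 := by
    refine (hξ.add hη).div (Complex.continuous_ofReal.comp (continuous_const.add hnorm)) fun q => ?_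
    exact_mod_cast (by positivity : (2 + ‖(q.1.1.1 : ℂ) - q.1.1.2‖ : ℝ) ≠ 0)
  have hu : Continuous fun q : OrderedPair Circle × ℝ => centerDirection q.1.1.1 q.1.1.2 :=
    (hη.sub hξ).div (Complex.continuous_ofReal.comp hnorm) fun q => by exact_mod_cast hpos q
  have hT : Continuous fun q : OrderedPair Circle × ℝ => ((Real.tanh (q.2 / 2) : ℝ) : ℂ) :=
    Complex.continuous_ofReal.comp (continuous_real_tanh.comp (by fun_prop))
  have hD : Continuous fun q : OrderedPair Circle × ℝ => geodesicDen q.1.1.1 q.1.1.2 q.2 :=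
    ((Complex.continuous_conj.comp hc).mul (hu.mul hT)).add continuous_const
  have hD0 : ∀ q : OrderedPair Circle × ℝ, geodesicDen q.1.1.1 q.1.1.2 q.2 ≠ 0 := fun q =>
    geodesicDen_ne_zero q.1.2 q.2
  refine Continuous.prodMk ?_ ?_
  · rw [UnitDisc.isEmbedding_coe.continuous_iff]
    exact ((continuous_const.mul (hu.mul hT)).add hc).div hD hD0
  · exact (((Complex.continuous_conj.comp hD).div hD hD0).subtype_mk _).mul (hu.subtype_mk _)

theorem continuous_hopfCoord : Continuous hopfCoord := by
  have hx : Continuous fun v : UnitDisc × Circle => (v.1 : ℂ) :=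
    UnitDisc.continuous_coe.comp continuous_fst
  have hu : Continuous fun v : UnitDisc × Circle => (v.2 : ℂ) :=
    continuous_circle_coe.comp continuous_snd
  have hp : ∀ v : UnitDisc × Circle, 1 + conj (v.1 : ℂ) * v.2 ≠ 0 := fun v =>
    ray_den_ne_zero v.1.norm_lt_one v.2.norm_coe
  have hm : ∀ v : UnitDisc × Circle, 1 + conj (v.1 : ℂ) * -v.2 ≠ 0 := fun v =>
    ray_den_ne_zero v.1.norm_lt_one (by rw [norm_neg, v.2.norm_coe])
  have hdp : Continuous fun v : UnitDisc × Circle => 1 + conj (v.1 : ℂ) * v.2 :=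
    continuous_const.add ((Complex.continuous_conj.comp hx).mul hu)
  have hdm : Continuous fun v : UnitDisc × Circle => 1 + conj (v.1 : ℂ) * -v.2 :=
    continuous_const.add ((Complex.continuous_conj.comp hx).mul hu.neg)
  refine Continuous.prodMk (Continuous.subtype_mk (Continuous.prodMk ?_ ?_) _) ?_
  · exact ((hx.add hu.neg).div hdm hm).subtype_mk _
  · exact ((hx.add hu).div hdp hp).subtype_mk _
  · exact (hdp.norm.div hdm.norm fun v => norm_ne_zero_iff.2 (hm v)).log fun v =>
      (rayRatio_pos v.1.norm_lt_one v.2.norm_coe).ne'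

/-- Hopf coordinates identify the product of the space of oriented geodesics with the line with the
unit tangent bundle. -/
def hopfHomeomorph : OrderedPair Circle × ℝ ≃ₜ UnitDisc × Circle where
  toFun := hopfPoint
  invFun := hopfCoord
  left_inv := hopfCoord_hopfPoint
  right_inv _ := hopfCoord_injective (hopfCoord_hopfPoint _)
  continuous_toFun := continuous_hopfPoint
  continuous_invFun := continuous_hopfCoord

/-- The centered segment at time `t` of an oriented geodesic. -/
def hopfCentered (q : OrderedPair Circle × ℝ) : CenteredSegments :=
  centeredAt q.1.1.1 q.1.1.2 q.1.2 q.2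

theorem isProperMap_hopfCentered : IsProperMap hopfCentered :=
  isInvolutionQuotient_centeredMk.isProperMap.comp
    ((IsClosedEmbedding.id.prodMap isClosedEmbedding_circleToClosedDisc).isProperMap.comp
      hopfHomeomorph.isProperMap)

/-- The fibres of the parametrization of the centered bi-infinite segments. -/
theorem eq_of_hopfCentered_eq {q q' : OrderedPair Circle × ℝ}
    (h : hopfCentered q = hopfCentered q') :
    q.1.toUnordered = q'.1.toUnordered ∧ (q'.2 = q.2 ∨ q'.2 = -q.2) := by
  rw [← hopfCoord_hopfPoint q, ← hopfCoord_hopfPoint q']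
  rcases (isInvolutionQuotient_centeredMk.eq_iff
    ((hopfPoint q).1, circleToClosedDisc (hopfPoint q).2)
    ((hopfPoint q').1, circleToClosedDisc (hopfPoint q').2)).1 h with h' | h'
  · have h1 : hopfPoint q' = hopfPoint q :=
      Prod.ext (Prod.mk.inj h').1 (circleToClosedDisc_injective (Prod.mk.inj h').2)
    rw [h1]
    exact ⟨rfl, Or.inl rfl⟩
  · obtain ⟨⟨x, u⟩, hv⟩ : ∃ v, v = hopfPoint q := ⟨_, rfl⟩
    have h1 : hopfPoint q' = (x, -u) := by
      rw [← hv] at h'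
      exact Prod.ext (Prod.mk.inj h').1 (circleToClosedDisc_injective (Prod.mk.inj h').2)
    rw [h1, ← hv]
    have hneg : ((-u : Circle) : ℂ) = -(u : ℂ) := rfl
    constructor
    · refine UnorderedPair.mk_eq_mk_iff.2 (Or.inr ⟨Circle.ext ?_, Circle.ext ?_⟩)
      · change rayEnd x (-((-u : Circle) : ℂ)) = rayEnd x u
        rw [hneg, neg_neg]
      · change rayEnd x ((-u : Circle) : ℂ) = rayEnd x (-(u : ℂ))
        rw [hneg]
    · right
      change Real.log (rayRatio x ((-u : Circle) : ℂ)) = -Real.log (rayRatio x u)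
      rw [← Real.log_inv, rayRatio, rayRatio, inv_div, hneg, neg_neg]

/-- An isometry maps a geodesic to its image by a translation of the arclength parameter. -/
theorem exists_actCentered_hopfCentered (g : SU11) (p : OrderedPair Circle) :
    ∃ c : ℝ, ∀ t, actCentered g (hopfCentered (p, t)) = hopfCentered
      (⟨(g.onCircle p.1.1, g.onCircle p.1.2), fun h => p.2 (g.onCircle_injective h)⟩, t + c) := by
  refine ⟨Real.log (‖conj g.b * (p.1.2 : ℂ) + conj g.a‖ / ‖conj g.b * (p.1.1 : ℂ) + conj g.a‖),
    fun t => ?_⟩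
  set c := Real.log (‖conj g.b * (p.1.2 : ℂ) + conj g.a‖ / ‖conj g.b * (p.1.1 : ℂ) + conj g.a‖)
    with hc
  set p' : OrderedPair Circle := ⟨(g.onCircle p.1.1, g.onCircle p.1.2),
    fun h => p.2 (g.onCircle_injective h)⟩ with hp'
  obtain ⟨h1, h2, h3⟩ := rayEnd_geodesicPoint p.2 t
  obtain ⟨⟨x, u⟩, hv⟩ : ∃ v, v = hopfPoint (p, t) := ⟨_, rfl⟩
  have hx : geodesicPoint p.1.1 p.1.2 p.2 t = x := (congrArg Prod.fst hv).symm
  have hu : unitDirection p.1.1 p.1.2 p.2 t = u := (congrArg Prod.snd hv).symm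
  rw [hx, hu] at h1 h2 h3
  have hu' : ‖-(u : ℂ)‖ = 1 := by rw [norm_neg, u.norm_coe]
  have key : ((g.onDisc x, g.unitDeriv x * u) : UnitDisc × Circle) = hopfPoint (p', t + c) := by
    refine hopfCoord_injective ?_
    rw [hopfCoord_hopfPoint]
    refine Prod.ext (Subtype.ext (Prod.ext (Circle.ext ?_) (Circle.ext ?_))) ?_
    · change rayEnd (g.mobius x) (-((g.unitDeriv x : ℂ) * u)) = g.mobius p.1.1
      rw [← mul_neg]
      exact (rayEnd_mobius g.norm_b_lt x.norm_lt_one hu').trans (by rw [h2]; rfl)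
    · change rayEnd (g.mobius x) ((g.unitDeriv x : ℂ) * u) = g.mobius p.1.2
      exact (rayEnd_mobius g.norm_b_lt x.norm_lt_one u.norm_coe).trans (by rw [h1]; rfl)
    · change Real.log (rayRatio (g.mobius x) ((g.unitDeriv x : ℂ) * u)) = t + c
      have h4 := rayRatio_mobius g.norm_b_lt x.norm_lt_one u.norm_coe
      rw [h1, h2, h3] at h4
      refine (congrArg Real.log h4).trans ?_
      rw [Real.log_mul ?_ (Real.exp_ne_zero t), Real.log_exp, add_comm]
      exact div_ne_zero (norm_ne_zero_iff.2 (den_ne_zero g.norm_b_lt p.1.2.norm_coe.le))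
        (norm_ne_zero_iff.2 (den_ne_zero g.norm_b_lt p.1.1.norm_coe.le))
  have h5 : hopfCentered (p', t + c)
      = CenteredSegments.mk (g.onDisc x) (circleToClosedDisc (g.unitDeriv x * u)) := by
    change CenteredSegments.mk (hopfPoint (p', t + c)).1
      (circleToClosedDisc (hopfPoint (p', t + c)).2) = _
    rw [← key]
  rw [h5]
  change CenteredSegments.mk (g.onDisc (hopfPoint (p, t)).1)
    (g.unitDeriv (hopfPoint (p, t)).1 • circleToClosedDisc (hopfPoint (p, t)).2) = _
  rw [← hv]
  rfl

/-! ### Integration along geodesics -/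

theorem continuous_hopfCentered_right (p : OrderedPair Circle) :
    Continuous fun t => hopfCentered (p, t) :=
  isProperMap_hopfCentered.continuous.comp (Continuous.prodMk_right p)

theorem arclengthMeasure_toUnordered (p : OrderedPair Circle) :
    arclengthMeasure p.toUnordered = (volume : Measure ℝ).map fun t => hopfCentered (p, t) :=
  rfl

theorem arclengthMeasure_actGeodesics (g : SU11) (γ : Geodesics) :
    arclengthMeasure (actGeodesics g γ) = (arclengthMeasure γ).map (actCentered g) := by
  induction γ using UnorderedPair.ind with | h p
  obtain ⟨c, hc⟩ := exists_actCentered_hopfCentered g p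
  set p' : OrderedPair Circle := ⟨(g.onCircle p.1.1, g.onCircle p.1.2),
    fun h => p.2 (g.onCircle_injective h)⟩ with hp'
  change arclengthMeasure p'.toUnordered = _
  rw [arclengthMeasure_toUnordered, arclengthMeasure_toUnordered, Measure.map_map
    (continuous_actCentered g).measurable (continuous_hopfCentered_right p).measurable]
  have h1 : (actCentered g ∘ fun t => hopfCentered (p, t))
      = (fun t => hopfCentered (p', t)) ∘ fun t => t + c := funext hc
  rw [h1, ← Measure.map_map (continuous_hopfCentered_right p').measurable
    (measurable_add_const c), map_add_right_eq_self]

theorem measurable_arclengthMeasure : Measurable arclengthMeasure := by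
  have : PolishSpace (OrderedPair Circle) := (isOpen_ne_pair Circle).polishSpace
  borelize (OrderedPair Circle)
  have hπ := (OrderedPair.isInvolutionQuotient_toUnordered Circle).isQuotientMap
  refine Measure.measurable_of_measurable_coe _ fun A hA => ?_
  intro s hs
  rw [← hπ.continuous.measurable.measurableSet_preimage_iff_of_surjective hπ.surjective]
  have h1 : ∀ p : OrderedPair Circle, arclengthMeasure p.toUnordered A
      = volume (Prod.mk p ⁻¹' (hopfCentered ⁻¹' A)) := fun p => by
    rw [arclengthMeasure_toUnordered,
      Measure.map_apply (continuous_hopfCentered_right p).measurable hA]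
    rfl
  have h2 : Measurable fun p : OrderedPair Circle => arclengthMeasure p.toUnordered A := by
    simp only [h1]
    exact measurable_measure_prodMk_left (isProperMap_hopfCentered.continuous.measurable hA)
  exact h2 hs

theorem continuous_integral_of_compactSupport {A : Type*} [TopologicalSpace A]
    [FirstCountableTopology A] [LocallyCompactSpace A] (k : C_c(A × ℝ, ℝ)) :
    Continuous fun a => ∫ t, k (a, t) := by
  have hK : IsCompact (Prod.snd '' tsupport k) := k.hasCompactSupport.isCompact.image continuous_snd
  refine (continuous_parametric_integral_of_continuous (μ := volume) (f := fun a t => k (a, t))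
    k.continuous hK).congr fun a => ?_
  refine setIntegral_eq_integral_of_forall_compl_eq_zero fun t ht => ?_
  exact image_eq_zero_of_notMem_tsupport fun h => ht ⟨_, h, rfl⟩

/-- The pull-back of a test function on centered segments to Hopf coordinates. -/
def hopfPullback (f : C_c(CenteredSegments, ℝ)) : C_c(OrderedPair Circle × ℝ, ℝ) :=
  ⟨⟨fun q => f (hopfCentered q), f.continuous.comp isProperMap_hopfCentered.continuous⟩,
    HasCompactSupport.intro (isProperMap_hopfCentered.isCompact_preimage f.hasCompactSupport)
      fun q hq => image_eq_zero_of_notMem_tsupport (f := f) (x := hopfCentered q) hq⟩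

theorem integrable_hopfPullback (f : C_c(CenteredSegments, ℝ)) (p : OrderedPair Circle) :
    Integrable fun t => hopfPullback f (p, t) := by
  have hc : Continuous fun t => hopfPullback f (p, t) :=
    (map_continuous (hopfPullback f)).comp (Continuous.prodMk_right p)
  refine hc.integrable_of_hasCompactSupport (HasCompactSupport.intro
    ((hopfPullback f).hasCompactSupport.isCompact.image continuous_snd) fun t ht => ?_)
  exact image_eq_zero_of_notMem_tsupport fun h => ht ⟨(p, t), h, rfl⟩

theorem integral_arclengthMeasure (f : C_c(CenteredSegments, ℝ)) (p : OrderedPair Circle) :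
    ∫ y, f y ∂arclengthMeasure p.toUnordered = ∫ t, hopfPullback f (p, t) := by
  rw [arclengthMeasure_toUnordered,
    integral_map (continuous_hopfCentered_right p).measurable.aemeasurable
      (map_continuous f).aestronglyMeasurable]
  rfl

theorem integrable_arclengthMeasure (f : C_c(CenteredSegments, ℝ)) (γ : Geodesics) :
    Integrable f (arclengthMeasure γ) := by
  induction γ using UnorderedPair.ind with | h p
  rw [arclengthMeasure_toUnordered, integrable_map_measure (map_continuous f).aestronglyMeasurable
    (continuous_hopfCentered_right p).measurable.aemeasurable]
  exact integrable_hopfPullback f p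

/-- Integration of test functions on centered segments along all bi-infinite geodesics. -/
def integrateAlong : C_c(CenteredSegments, ℝ) →ₗ[ℝ] C_c(Geodesics, ℝ) where
  toFun f :=
    { toFun := fun γ => ∫ y, f y ∂arclengthMeasure γ
      continuous_toFun := by
        rw [(OrderedPair.isInvolutionQuotient_toUnordered Circle).isQuotientMap.continuous_iff]
        exact (continuous_integral_of_compactSupport (hopfPullback f)).congr fun p =>
          (integral_arclengthMeasure f p).symm
      hasCompactSupport' := by
        refine HasCompactSupport.intro (((hopfPullback f).hasCompactSupport.isCompact.image
          continuous_fst).image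
          (OrderedPair.isInvolutionQuotient_toUnordered Circle).isQuotientMap.continuous)
          fun γ hγ => ?_
        induction γ using UnorderedPair.ind with | h p
        rw [integral_arclengthMeasure]
        refine integral_eq_zero_of_ae (Eventually.of_forall fun t => ?_)
        exact image_eq_zero_of_notMem_tsupport fun h => hγ ⟨p, ⟨_, h, rfl⟩, rfl⟩ }
  map_add' f f' := CompactlySupportedContinuousMap.ext fun γ =>
    integral_add (integrable_arclengthMeasure f γ) (integrable_arclengthMeasure f' γ)
  map_smul' c f := CompactlySupportedContinuousMap.ext fun γ => integral_const_mul c f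

/-- Every test function on geodesics is an integral along geodesics: it is multiplied with an even
bump function of the arclength parameter of total mass `1`. -/
theorem exists_integrateAlong_eq (f : C_c(Geodesics, ℝ)) :
    ∃ φ, integrateAlong φ = f ∧ ((∀ γ, 0 ≤ f γ) → ∀ y, 0 ≤ φ y) := by
  have hπ := OrderedPair.isInvolutionQuotient_toUnordered Circle
  let β : ContDiffBump (0 : ℝ) := default
  let k : C_c(OrderedPair Circle × ℝ, ℝ) :=
    { toFun := fun q => f q.1.toUnordered * β.normed volume q.2
      continuous_toFun := ((f.continuous.comp hπ.isQuotientMap.continuous).comp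
        continuous_fst).mul (β.continuous_normed.comp continuous_snd)
      hasCompactSupport' := by
        refine HasCompactSupport.intro ((hπ.isProperMap.isCompact_preimage
          f.hasCompactSupport.isCompact).prod
          (β.hasCompactSupport_normed (μ := volume)).isCompact) fun q hq => ?_
        by_cases h : q.1.toUnordered ∈ tsupport f
        · exact mul_eq_zero_of_right _ (image_eq_zero_of_notMem_tsupport fun h' => hq ⟨h, h'⟩)
        · exact mul_eq_zero_of_left (image_eq_zero_of_notMem_tsupport h) _ }
  have hk : ∀ q, k q = f q.1.toUnordered * β.normed volume q.2 := fun _ => rfl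
  obtain ⟨φ, hφ, hpos⟩ := exists_comp_eq_of_isProperMap isProperMap_hopfCentered k (by
    intro q q' h
    obtain ⟨h1, h2⟩ := eq_of_hopfCentered_eq h
    rw [hk, hk, h1]
    rcases h2 with h2 | h2 <;> rw [h2]
    rw [ContDiffBump.normed_neg])
  refine ⟨φ, CompactlySupportedContinuousMap.ext fun γ => ?_,
    fun hf => hpos fun q => mul_nonneg (hf _) (β.nonneg_normed _)⟩
  induction γ using UnorderedPair.ind with | h p
  change ∫ y, φ y ∂arclengthMeasure p.toUnordered = _
  rw [integral_arclengthMeasure]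
  change ∫ t, φ (hopfCentered (p, t)) = _
  simp only [hφ, hk]
  rw [integral_const_mul, β.integral_normed, mul_one]

/-! ### Currents as centered currents -/

theorem integrateAlong_nonneg {f : C_c(CenteredSegments, ℝ)} (hf : ∀ y, 0 ≤ f y) (γ : Geodesics) :
    0 ≤ integrateAlong f γ :=
  integral_nonneg hf

theorem lintegral_toCentered (μ : Measure Geodesics) {f : C_c(CenteredSegments, ℝ)}
    (hf : ∀ y, 0 ≤ f y) :
    ∫⁻ y, ENNReal.ofReal (f y) ∂toCentered μ = ∫⁻ γ, ENNReal.ofReal (integrateAlong f γ) ∂μ := by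
  rw [toCentered, Measure.lintegral_bind measurable_arclengthMeasure.aemeasurable
    ((map_continuous f).measurable.ennreal_ofReal).aemeasurable]
  refine lintegral_congr fun γ => ?_
  exact (ofReal_integral_eq_lintegral_ofReal (integrable_arclengthMeasure f γ)
    (Eventually.of_forall hf)).symm

theorem regular_toCentered (μ : Measure Geodesics) (hμ : μ.Regular) : (toCentered μ).Regular := by
  refine regular_of_isCompact_lt_top fun K hK => ?_
  obtain ⟨χ, hχ1, -, hχc, hχ⟩ :=
    exists_continuous_one_zero_of_isCompact hK isClosed_empty (Set.disjoint_empty _)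
  let f : C_c(CenteredSegments, ℝ) := ⟨χ, hχc⟩
  have hint : Integrable (integrateAlong f) μ :=
    (integrateAlong f).continuous.integrable_of_hasCompactSupport
      (integrateAlong f).hasCompactSupport
  calc toCentered μ K = ∫⁻ y, K.indicator 1 y ∂toCentered μ :=
        (lintegral_indicator_one hK.measurableSet).symm
    _ ≤ ∫⁻ y, ENNReal.ofReal (f y) ∂toCentered μ := by
        refine lintegral_mono fun y => ?_
        by_cases hy : y ∈ K
        · have h1 : f y = 1 := hχ1 hy
          simp [hy, h1]
        · simp [hy]
    _ = ∫⁻ γ, ENNReal.ofReal (integrateAlong f γ) ∂μ := lintegral_toCentered μ fun y => (hχ y).1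
    _ < ⊤ := by
        rw [← ofReal_integral_eq_lintegral_ofReal hint
          (Eventually.of_forall (integrateAlong_nonneg fun y => (hχ y).1))]
        exact ENNReal.ofReal_lt_top

theorem integral_toCentered (μ : Measure Geodesics) (hμ : μ.Regular)
    (f : C_c(CenteredSegments, ℝ)) :
    ∫ y, f y ∂toCentered μ = ∫ γ, integrateAlong f γ ∂μ := by
  have hpos : ∀ f : C_c(CenteredSegments, ℝ), (∀ y, 0 ≤ f y) →
      ∫ y, f y ∂toCentered μ = ∫ γ, integrateAlong f γ ∂μ := by
    intro f hf
    rw [integral_eq_lintegral_of_nonneg_ae (Eventually.of_forall hf)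
      (map_continuous f).aestronglyMeasurable, lintegral_toCentered μ hf,
      integral_eq_lintegral_of_nonneg_ae (Eventually.of_forall (integrateAlong_nonneg hf))
      (map_continuous (integrateAlong f)).aestronglyMeasurable]
  have := regular_toCentered μ hμ
  have hi : ∀ f : C_c(CenteredSegments, ℝ), Integrable f (toCentered μ) := fun f =>
    f.continuous.integrable_of_hasCompactSupport f.hasCompactSupport
  have hi' : ∀ f : C_c(Geodesics, ℝ), Integrable f μ := fun f =>
    f.continuous.integrable_of_hasCompactSupport f.hasCompactSupport
  obtain ⟨a, b, ha, hb, rfl⟩ : ∃ a b : C_c(CenteredSegments, ℝ), (∀ y, 0 ≤ a y) ∧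
      (∀ y, 0 ≤ b y) ∧ f = a - b := by
    refine ⟨f ⊔ 0, (-f) ⊔ 0, fun y => le_max_right _ _, fun y => le_max_right _ _, ?_⟩
    refine CompactlySupportedContinuousMap.ext fun y => ?_
    exact (max_zero_sub_max_neg_zero_eq_self (f y)).symm
  rw [map_sub]
  calc ∫ y, (a - b) y ∂toCentered μ = ∫ y, a y ∂toCentered μ - ∫ y, b y ∂toCentered μ :=
        integral_sub (hi a) (hi b)
    _ = ∫ γ, integrateAlong a γ ∂μ - ∫ γ, integrateAlong b γ ∂μ := by rw [hpos a ha, hpos b hb]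
    _ = ∫ γ, (integrateAlong a - integrateAlong b) γ ∂μ := (integral_sub (hi' _) (hi' _)).symm

theorem toCentered_map_actGeodesics (g : SU11) (μ : Measure Geodesics) :
    toCentered (μ.map (actGeodesics g)) = (toCentered μ).map (actCentered g) := by
  have hG := (continuous_actGeodesics g).measurable
  have hC := (continuous_actCentered g).measurable
  ext A hA
  rw [toCentered, toCentered, Measure.bind_apply hA measurable_arclengthMeasure.aemeasurable,
    lintegral_map (f := fun γ => arclengthMeasure γ A)
      ((Measure.measurable_coe hA).comp measurable_arclengthMeasure) hG,
    Measure.map_apply hC hA,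
    Measure.bind_apply (hC hA) measurable_arclengthMeasure.aemeasurable]
  refine lintegral_congr fun γ => ?_
  rw [arclengthMeasure_actGeodesics, Measure.map_apply hC hA]

/-- The map from geodesic currents to centered currents with corners is dual to the integration of
test functions along geodesics. -/
theorem exists_isClosedEmbedding_toCentered (S : ClosedHyperbolicSurface) :
    ∃ F : GeodesicCurrent S → CenteredCurrentWithCorners S,
      (∀ μ, (F μ).1 = toCentered μ.1) ∧ IsClosedEmbedding F :=
  exists_isClosedEmbedding_of_dual (Γ := S.deck) (actX := actGeodesics) (actY := actCentered)
    toCentered integrateAlong regular_toCentered integral_toCentered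
    (fun g _ => regular_map_actGeodesics g) (fun g _ μ _ => toCentered_map_actGeodesics g μ)
    exists_integrateAlong_eq

end CurrentsWithCorners

end

theorem mainTheorem6 (S : CurrentsWithCorners.ClosedHyperbolicSurface) :
    (∃ F : CurrentsWithCorners.GeodesicCurrent S → CurrentsWithCorners.CurrentWithCorners S,
      (∀ μ, (F μ).1 = CurrentsWithCorners.toSegments μ.1) ∧ Topology.IsClosedEmbedding F) ∧
    (∃ F : CurrentsWithCorners.GeodesicCurrent S →
        CurrentsWithCorners.CenteredCurrentWithCorners S,
      (∀ μ, (F μ).1 = CurrentsWithCorners.toCentered μ.1) ∧ Topology.IsClosedEmbedding F) :=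
  ⟨CurrentsWithCorners.exists_isClosedEmbedding_toSegments S,
    CurrentsWithCorners.exists_isClosedEmbedding_toCentered S⟩
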